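/- Let $\Omega$ be the set of permutations of $[n]$ and $\mu$ the uniform distribution on $\Omega$. For $x,y\in[n]$ write $\langle x,y\rangle=\{\pi\in\Omega:\pi x=y\}$ (an atomic event). Let $\mathcal F$ be a set of flaws, each of the form $f=\langle x_1,y_1\rangle\cap\dots\cap\langle x_t,y_t\rangle$ with $x_1,\dots,x_t$ distinct and $y_1,\dots,y_t$ distinct; fix one such representation (in an arbitrary order) of each $f \in \mathcal F$. To resample $f$ on a state $\pi\in f$, do the following for $i=1,\dots,t$ in turn: draw $z_i$ uniformly from $[n]\setminus\{y_{i+1},\dots,y_t\}$ and replace $\pi$ by $(y_i\ z_i)\,\pi$. Let $A_f[\sigma,\tau]$ be the probability that resampling $f$ on $\sigma$ yields $\tau$ if $\sigma\in f$, and $A_f[\sigma,\tau]=0$ if $\sigma\notin f$, and let $\gamma_f=\max_{\tau\in\Omega}\sum_{\sigma\in f}\frac{\mu(\sigma)}{\mu(\tau)}A_f[\sigma,\tau]$. For $f,g\in\mathcal F$ write $f\sim g$ if $f=g$ or $f\cap g=\emptyset$. A witness DAG is a finite directed acyclic graph whose vertices $v$ have labels $L(v)\in\mathcal F$, such that distinct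 vertices $v,w$ are joined by an edge (in one of the two directions) if and only if $L(v)\sim L(w)$. For $f\in\mathcal F$ let $$\Psi(f)=\sum_{H}\ \prod_{v\in H}\gamma_{L(v)}\ \in[0,\infty],$$ where $H$ ranges over all witness DAGs, up to isomorphism, whose set of labels of sink nodes is $\{f\}$. Consider the local search algorithm that draws the initial state from $\mu$ and, as long as some flaw holds on the current state, selects a flaw that holds on it and resamples this flaw. The selection may be randomized and may depend on the whole history of the execution. For an event $E\subseteq\Omega$ let $P(E)$ be the probability that $E$ holds at any time during the execution. **Theorem.** Let $0\le r\le n$, let $(x_1,y_1),\dots,(x_r,y_r)\in[n]\times[n]$ be distinct pairs, let $g_i=\langle x_i,y_i\rangle$ and $E=g_1\cap\dots\cap g_r$. Then, for every selection rule, $$P(E)\ \le\ \frac{(n-r)!}{n!}\ \prod_{i=1}^r\Bigl(1+\sum_{f\in\mathcal F:\ f\cap g_i=\emptyset}\Psi(f)\Bigr).$$ -/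

import Mathlib

open scoped ENNReal

namespace LLL

noncomputable section

/-! ### Flaws, resampling oracles and the local search algorithm -/

/-- A family of flaws (events in the state space `Ω`), together with a randomized resampling
procedure for each of them. The procedure of `f` is only ever applied to states in `f`. -/
structure ResamplingOracle (Ω : Type) where
  flaws : Set (Set Ω)
  resample : flaws → Ω → PMF Ω

/-- The transition matrix `A_f`; its rows outside `f` vanish. -/
def ResamplingOracle.transition {Ω : Type} (R : ResamplingOracle Ω) (f : R.flaws)
    (σ τ : Ω) : ℝ≥0∞ :=
  Set.indicator (f : Set Ω) (fun σ' => R.resample f σ' τ) σ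

/-- The charge `γ_f = max_τ ∑_{σ ∈ f} (μ σ / μ τ) A_f[σ, τ]`. -/
def ResamplingOracle.charge {Ω : Type} (R : ResamplingOracle Ω) (μ : PMF Ω) (f : R.flaws) :
    ℝ≥0∞ :=
  ⨆ τ : Ω, ∑' σ : (f : Set Ω), μ σ / μ τ * R.transition f σ τ

/-- The record of an execution up to some time: the initial state, and the flaws that were
resampled, each with the state that this produced, the most recent one first. -/
structure History {Ω : Type} (R : ResamplingOracle Ω) where
  init : Ω
  steps : List (R.flaws × Ω)

/-- The current state. -/
def History.current {Ω : Type} {R : ResamplingOracle Ω} (h : History R) : Ω :=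
  match h.steps with
  | [] => h.init
  | p :: _ => p.2

/-- The event `E` held at some time of the recorded execution. -/
def History.Visits {Ω : Type} {R : ResamplingOracle Ω} (h : History R) (E : Set Ω) : Prop :=
  h.init ∈ E ∨ ∃ p ∈ h.steps, p.2 ∈ E

/-- A flaw selection rule: if some flaw holds on the current state, it selects such a flaw, at
random, with a distribution which may depend on the whole history. -/
structure SelectionRule {Ω : Type} (R : ResamplingOracle Ω) where
  select : (h : History R) → (∃ f : R.flaws, h.current ∈ (f : Set Ω)) → PMF R.flaws
  select_holds : ∀ h hf, ∀ f ∈ (select h hf).support, h.current ∈ (f : Set Ω)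

open Classical in
/-- One iteration of the local search: select a flaw of the current state and resample it; nothing
happens any more once the state is flawless. -/
def SelectionRule.step {Ω : Type} {R : ResamplingOracle Ω} (S : SelectionRule R)
    (h : History R) : PMF (History R) :=
  if hf : ∃ f : R.flaws, h.current ∈ (f : Set Ω) then
    (S.select h hf).bind fun f =>
      (R.resample f h.current).map fun σ => ⟨h.init, (f, σ) :: h.steps⟩
  else PMF.pure h

/-- The law of the history of the local search after (at most) `t` iterations, when the initial
state is drawn from `μ`. -/
def SelectionRule.run {Ω : Type} {R : ResamplingOracle Ω} (S : SelectionRule R) (μ : PMF Ω) :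
    ℕ → PMF (History R)
  | 0 => μ.map fun σ => ⟨σ, []⟩
  | t + 1 => (S.run μ t).bind S.step

/-- `P(E)`, the probability that `E` holds at any time of the execution: the limit of the
increasing probabilities that it holds at one of the times `0, …, t`. -/
def SelectionRule.hitProb {Ω : Type} {R : ResamplingOracle Ω} (S : SelectionRule R) (μ : PMF Ω)
    (E : Set Ω) : ℝ≥0∞ :=
  ⨆ t : ℕ, (S.run μ t).toOuterMeasure {h | h.Visits E}

/-! ### Witness DAGs -/

/-- A witness DAG with labels in `ι`, for the dependency relation `dep`. -/
structure Wdag {ι : Type} (dep : ι → ι → Prop) where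
  size : ℕ
  label : Fin size → ι
  edge : Fin size → Fin size → Prop
  acyclic : ∀ v, ¬ Relation.TransGen edge v v
  edge_iff : ∀ v w, v ≠ w → ((edge v w ∨ edge w v) ↔ dep (label v) (label w))

/-- Isomorphism of labelled directed graphs. -/
def Wdag.Iso {ι : Type} {dep : ι → ι → Prop} (G H : Wdag dep) : Prop :=
  ∃ e : Fin G.size ≃ Fin H.size,
    (∀ v, H.label (e v) = G.label v) ∧ ∀ v w, H.edge (e v) (e w) ↔ G.edge v w

instance Wdag.setoid {ι : Type} (dep : ι → ι → Prop) : Setoid (Wdag dep) where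
  r := Wdag.Iso
  iseqv :=
    { refl := fun _ => ⟨Equiv.refl _, fun _ => rfl, fun _ _ => Iff.rfl⟩
      symm := fun ⟨e, hl, he⟩ => ⟨e.symm,
        fun v => by rw [← hl (e.symm v), e.apply_symm_apply],
        fun v w => by rw [← he, e.apply_symm_apply, e.apply_symm_apply]⟩
      trans := fun ⟨e, hl, he⟩ ⟨e', hl', he'⟩ => ⟨e.trans e',
        fun v => by rw [Equiv.trans_apply, hl', hl],
        fun v w => by rw [Equiv.trans_apply, Equiv.trans_apply, he', he]⟩ }

/-- The set of labels of the sink nodes. -/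
def Wdag.sinks {ι : Type} {dep : ι → ι → Prop} (H : Wdag dep) : Set ι :=
  {f | ∃ v, H.label v = f ∧ ∀ w, ¬ H.edge v w}

/-- The weight `w(H)`, the product of the charges of the labels. -/
def Wdag.weight {ι : Type} {dep : ι → ι → Prop} (γ : ι → ℝ≥0∞) (H : Wdag dep) : ℝ≥0∞ :=
  ∏ v, γ (H.label v)

theorem Wdag.sinks_subset_of_iso {ι : Type} {dep : ι → ι → Prop} {G H : Wdag dep}
    (h : G.Iso H) : G.sinks ⊆ H.sinks := by
  obtain ⟨e, hl, he⟩ := h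
  rintro f ⟨v, rfl, hv⟩
  refine ⟨e v, hl v, fun w hw => hv (e.symm w) ?_⟩
  rw [← he, e.apply_symm_apply]
  exact hw

theorem Wdag.sinks_eq_of_iso {ι : Type} {dep : ι → ι → Prop} (G H : Wdag dep)
    (h : G ≈ H) : G.sinks = H.sinks :=
  Set.Subset.antisymm (sinks_subset_of_iso h) (sinks_subset_of_iso (Setoid.symm h))

theorem Wdag.weight_eq_of_iso {ι : Type} {dep : ι → ι → Prop} (γ : ι → ℝ≥0∞) (G H : Wdag dep)
    (h : G ≈ H) : G.weight γ = H.weight γ := by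
  obtain ⟨e, hl, -⟩ := h
  exact Fintype.prod_equiv e _ _ fun v => by rw [hl]

/-- Witness DAGs up to isomorphism. -/
abbrev WdagClass {ι : Type} (dep : ι → ι → Prop) : Type := Quotient (Wdag.setoid dep)

def WdagClass.sinks {ι : Type} {dep : ι → ι → Prop} (H : WdagClass dep) : Set ι :=
  Quotient.lift Wdag.sinks Wdag.sinks_eq_of_iso H

def WdagClass.weight {ι : Type} {dep : ι → ι → Prop} (γ : ι → ℝ≥0∞) (H : WdagClass dep) :
    ℝ≥0∞ :=
  Quotient.lift (Wdag.weight γ) (Wdag.weight_eq_of_iso γ) H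

/-- `Ψ(I)`: the total weight (possibly infinite) of all witness DAGs, up to isomorphism, whose
set of sink labels is `I`. -/
def Psi {ι : Type} (dep : ι → ι → Prop) (γ : ι → ℝ≥0∞) (I : Set ι) : ℝ≥0∞ :=
  ∑' H : {H : WdagClass dep // H.sinks = I}, H.1.weight γ

/-! ### The permutation setting -/

/-- The atomic event `π x = y`, for `p = (x, y)`. -/
def atom {n : ℕ} (p : Fin n × Fin n) : Set (Equiv.Perm (Fin n)) :=
  {π | π p.1 = p.2}

/-- The resampling of `⟨x₁, y₁⟩ ∩ ⋯ ∩ ⟨x_t, y_t⟩`: for `i = 1, …, t` in turn, replace `π` by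
`(y_i z_i) π`, where `z_i` is uniform on the values for which `(y_i z_i)` fixes
`y_{i+1}, …, y_t`, i.e. for which the later atomic events remain true. For a single atomic event,
`z_1` is uniform on all of `Fin n`. -/
def permResample {n : ℕ} :
    List (Fin n × Fin n) → Equiv.Perm (Fin n) → PMF (Equiv.Perm (Fin n))
  | [], π => PMF.pure π
  | p :: L, π =>
    (PMF.uniformOfFinset
      (Finset.univ.filter fun z : Fin n => ∀ q ∈ L, Equiv.swap p.2 z q.2 = q.2)
      ⟨p.2, by simp⟩).bind fun z => permResample L (Equiv.swap p.2 z * π)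

/-- A flaw set of the permutation setting: every flaw is an intersection of mutually compatible
atomic events, listed in an arbitrary order. -/
structure PermSetting (n : ℕ) where
  flaws : Set (Set (Equiv.Perm (Fin n)))
  atoms : flaws → List (Fin n × Fin n)
  atoms_compatible : ∀ f, (atoms f).Pairwise fun p q => p.1 ≠ q.1 ∧ p.2 ≠ q.2
  eq_inter : ∀ f : flaws, (f : Set (Equiv.Perm (Fin n))) = ⋂ p ∈ atoms f, atom p

/-- The resampling oracle of the permutation setting. -/
def PermSetting.oracle {n : ℕ} (F : PermSetting n) : ResamplingOracle (Equiv.Perm (Fin n)) where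
  flaws := F.flaws
  resample f := permResample (F.atoms f)

/-- The uniform distribution on permutations. -/
def permUniform (n : ℕ) : PMF (Equiv.Perm (Fin n)) :=
  PMF.uniformOfFintype (Equiv.Perm (Fin n))

/-- The dependency relation: distinct flaws are dependent if they are disjoint, and every flaw
depends on itself. -/
def PermSetting.dep {n : ℕ} (F : PermSetting n) (f g : F.oracle.flaws) : Prop :=
  f = g ∨ (f : Set (Equiv.Perm (Fin n))) ∩ g = ∅

/-- `Ψ(f) = Ψ({f})` in the permutation setting. -/
def PermSetting.psi {n : ℕ} (F : PermSetting n) (f : F.oracle.flaws) : ℝ≥0∞ :=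
  Psi F.dep (F.oracle.charge (permUniform n)) {f}

end

end LLL

/-! The bound comes from a potential. If $U\ge 1$ on $E$ and, for every flaw $f$, resampling $f$ on
a state of $f$ does not increase the expectation of $U$, then
$P(E)\le\sum_\sigma\mu(\sigma)U(\sigma)$ for every selection rule: until $E$ is visited, $U$ of the
current state is a supermartingale, however the flaws are selected (`hitProb_le_of_potential`).

The potential sums, over witness DAGs for $E$, the product of the matrices $A_f$ along the DAG,
applied to $1_E$, with the sinks acting first. A DAG is stored by its layers: a set $I$ of sinks and
a list $L$ of further layers. Flaws that are not related by $\sim$ hold together on some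
permutation, so their atomic events are compatible and their matrices commute
(`atomMatrix_commute`). Hence multiplying by $A_f$ on the left amounts to adding $f$ as a new
source, which is an injective operation. The admitted sets $I$ are those that can be ordered so that
each flaw contradicts what remains of $E$ after the preceding ones, where "what remains" makes sense
because $A_f$ maps the indicator of a partial permutation to a multiple of another such indicator
(`listMatrix_mulVec_indicator`). If adding $f$ leads outside the admitted DAGs, then $f$ commutes
with the whole product and is compatible with the remaining $C$, so $A_f1_C\le 1_C$ and $f$ can be
dropped. Together these give $A_fU\le U$ (`mulVec_orderablePotential_le`).

For the value of $\mu\cdot U$, the inequality $\mu A_f\le\gamma_f\mu$ turns each product into the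
weight of its DAG times $\mu(E)$. The DAGs with sink set $I$ split into DAGs with single sinks
(`layerSum_le_prod`), each contributing at most $\Psi(f)$ (`layerSum_singleton_le_Psi`). Finally the
flaws of an admitted $I$ can be assigned to distinct $g_i$ that they contradict
(`Orderable.exists_isMatching`), so the sum over $I$ is part of the expansion of
$\prod_i(1+\sum_f\cdots)$ (`tsum_orderable_layerSum_le`). -/

namespace LLL

noncomputable section

/-! ### Layerings: witness DAGs in normal form -/

section Layers

set_option linter.unusedSectionVars false

variable {ι : Type} [DecidableEq ι] (dep : ι → ι → Prop)

/-- No two distinct elements of `I` are dependent. -/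
def Indep (I : Finset ι) : Prop := ∀ f ∈ I, ∀ g ∈ I, f ≠ g → ¬ dep f g

def Touches (f : ι) (I : Finset ι) : Prop := ∃ g ∈ I, dep f g

/-- `L` lists nonempty independent sets, each of whose elements depends on some element of the
preceding set, where `I` precedes the first one. -/
def IsLayering : Finset ι → List (Finset ι) → Prop
  | _, [] => True
  | I, J :: L => J.Nonempty ∧ Indep dep J ∧ (∀ f ∈ J, Touches dep f I) ∧ IsLayering J L

open Classical in
/-- Add `f` to the layer after the last one that it depends on. -/
def insertLayer (f : ι) : List (Finset ι) → List (Finset ι)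
  | [] => [{f}]
  | J :: L =>
    if ∃ K ∈ J :: L, Touches dep f K then J :: insertLayer f L else insert f J :: L

variable {dep}

theorem Touches.mono {f : ι} {I J : Finset ι} (h : Touches dep f I) (hIJ : I ⊆ J) :
    Touches dep f J :=
  let ⟨g, hg, hd⟩ := h
  ⟨g, hIJ hg, hd⟩

theorem IsLayering.mono {I J : Finset ι} {L : List (Finset ι)} (h : IsLayering dep I L)
    (hIJ : I ⊆ J) : IsLayering dep J L := by
  cases L with
  | nil => trivial
  | cons K L => exact ⟨h.1, h.2.1, fun f hf => (h.2.2.1 f hf).mono hIJ, h.2.2.2⟩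

theorem IsLayering.eq_nil {L : List (Finset ι)} (h : IsLayering dep ∅ L) : L = [] := by
  cases L with
  | nil => rfl
  | cons K L =>
    obtain ⟨f, hf⟩ := h.1
    obtain ⟨g, hg, -⟩ := h.2.2.1 f hf
    simp at hg

theorem Indep.subset {I J : Finset ι} (h : Indep dep J) (hIJ : I ⊆ J) : Indep dep I :=
  fun f hf g hg => h f (hIJ hf) g (hIJ hg)

theorem Indep.insert (hs : ∀ f g, dep f g → dep g f) {f : ι} {I : Finset ι} (h : Indep dep I)
    (hf : ¬ Touches dep f I) : Indep dep (insert f I) := by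
  intro a ha b hb hab hd
  rw [Finset.mem_insert] at ha hb
  rcases ha with rfl | ha <;> rcases hb with rfl | hb
  · exact hab rfl
  · exact hf ⟨b, hb, hd⟩
  · exact hf ⟨a, ha, hs _ _ hd⟩
  · exact h a ha b hb hab hd

theorem insertLayer_ne_nil (f : ι) (L : List (Finset ι)) : insertLayer dep f L ≠ [] := by
  cases L with
  | nil => simp [insertLayer]
  | cons J L => rw [insertLayer]; split_ifs <;> simp

theorem exists_mem_insertLayer (f : ι) (L : List (Finset ι)) :
    ∃ K ∈ insertLayer dep f L, f ∈ K := by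
  induction L with
  | nil => simp [insertLayer]
  | cons J L ih =>
    rw [insertLayer]
    split_ifs
    · obtain ⟨K, hK, hf⟩ := ih
      exact ⟨K, List.mem_cons_of_mem _ hK, hf⟩
    · exact ⟨_, List.mem_cons_self, Finset.mem_insert_self _ _⟩

theorem touches_insertLayer (hr : ∀ f, dep f f) (f : ι) (L : List (Finset ι)) :
    ∃ K ∈ insertLayer dep f L, Touches dep f K := by
  obtain ⟨K, hK, hf⟩ := exists_mem_insertLayer (dep := dep) f L
  exact ⟨K, hK, f, hf, hr f⟩

theorem IsLayering.insertLayer (hs : ∀ f g, dep f g → dep g f) {f : ι} {I : Finset ι}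
    {L : List (Finset ι)} (h : IsLayering dep I L)
    (hf : Touches dep f I ∨ ∃ K ∈ L, Touches dep f K) :
    IsLayering dep I (insertLayer dep f L) := by
  induction L generalizing I with
  | nil =>
    have hf : Touches dep f I := by simpa using hf
    refine ⟨Finset.singleton_nonempty f, ?_, ?_, trivial⟩
    · intro a ha b hb hab
      rw [Finset.mem_singleton] at ha hb
      exact absurd (ha.trans hb.symm) hab
    · intro a ha
      rw [Finset.mem_singleton] at ha
      rwa [ha]
  | cons J L ih =>
    obtain ⟨h1, h2, h3, h4⟩ := h
    rw [LLL.insertLayer]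
    split_ifs with ht
    · refine ⟨h1, h2, h3, ih h4 ?_⟩
      simpa using ht
    · have hf := hf.resolve_right ht
      refine ⟨Finset.insert_nonempty _ _, h2.insert hs fun hJ => ht ⟨J, List.mem_cons_self, hJ⟩,
        ?_, h4.mono (Finset.subset_insert _ _)⟩
      intro a ha
      rcases Finset.mem_insert.1 ha with rfl | ha
      · exact hf
      · exact h3 a ha

/-- The position of `f` can be read off the result: insertion went past the first layer exactly if
some later layer of the result touches `f`. At its final position `f` was not present before, so it
can be erased again. -/
theorem insertLayer_injective (hr : ∀ f, dep f f) {f : ι} {I I' : Finset ι}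
    {L L' : List (Finset ι)} (h : IsLayering dep I L) (h' : IsLayering dep I' L')
    (heq : insertLayer dep f L = insertLayer dep f L') : L = L' := by
  have key : ∀ (J : Finset ι) (L : List (Finset ι)), J.Nonempty →
      [{f}] ≠ insertLayer dep f (J :: L) := by
    intro J L hJ hc
    rw [insertLayer] at hc
    split_ifs at hc with ht
    · rw [List.cons.injEq] at hc
      exact insertLayer_ne_nil f L hc.2.symm
    · rw [List.cons.injEq] at hc
      obtain ⟨a, ha⟩ := hJ
      have : a ∈ ({f} : Finset ι) := hc.1 ▸ Finset.mem_insert_of_mem ha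
      rw [Finset.mem_singleton] at this
      subst this
      exact ht ⟨J, List.mem_cons_self, a, ha, hr a⟩
  induction L generalizing I I' L' with
  | nil =>
    cases L' with
    | nil => rfl
    | cons J' L' => exact absurd heq (key J' L' h'.1)
  | cons J L ih =>
    cases L' with
    | nil => exact absurd heq.symm (key J L h.1)
    | cons J' L' =>
      rw [insertLayer, insertLayer] at heq
      split_ifs at heq with h1 h2 h2
      · rw [List.cons.injEq] at heq
        rw [heq.1, ih h.2.2.2 h'.2.2.2 heq.2]
      · rw [List.cons.injEq] at heq
        obtain ⟨K, hK, ht⟩ := touches_insertLayer hr f L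
        exact absurd ⟨K, List.mem_cons_of_mem _ (heq.2 ▸ hK), ht⟩ h2
      · rw [List.cons.injEq] at heq
        obtain ⟨K, hK, ht⟩ := touches_insertLayer hr f L'
        exact absurd ⟨K, List.mem_cons_of_mem _ (heq.2 ▸ hK), ht⟩ h1
      · rw [List.cons.injEq] at heq
        have hJ : f ∉ J := fun hf => h1 ⟨J, List.mem_cons_self, f, hf, hr f⟩
        have hJ' : f ∉ J' := fun hf => h2 ⟨J', List.mem_cons_self, f, hf, hr f⟩
        rw [heq.2, ← Finset.erase_insert hJ, heq.1, Finset.erase_insert hJ']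

/-! ### Splitting a layering -/

variable (dep) in
open Classical in
/-- The part of a layering that is reachable from `I`. -/
def leftPart : Finset ι → List (Finset ι) → List (Finset ι)
  | _, [] => []
  | I, K :: L =>
    if K.filter (fun f => Touches dep f I) = ∅ then []
    else K.filter (fun f => Touches dep f I) ::
      leftPart (K.filter fun f => Touches dep f I) L

variable (dep) in
open Classical in
/-- The part of a layering that is not reachable from `I`. -/
def rightPart : Finset ι → List (Finset ι) → List (Finset ι)
  | _, [] => []
  | I, K :: L =>
    if K.filter (fun f => ¬ Touches dep f I) = ∅ then []
    else K.filter (fun f => ¬ Touches dep f I) ::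
      rightPart (K.filter fun f => Touches dep f I) L

/-- Layerwise union. -/
def mergeLayers : List (Finset ι) → List (Finset ι) → List (Finset ι)
  | [], L => L
  | L, [] => L
  | I :: L, J :: L' => (I ∪ J) :: mergeLayers L L'

theorem mergeLayers_nil (L : List (Finset ι)) : mergeLayers L [] = L := by
  cases L <;> rfl

theorem leftPart_empty (L : List (Finset ι)) : leftPart dep ∅ L = [] := by
  classical
  cases L with
  | nil => rfl
  | cons K L => rw [leftPart, if_pos]; simp [Touches]

/-- This justifies cutting off the right part at its first empty layer: from there on every layer is
reachable from the left part. -/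
theorem rightPart_self {I : Finset ι} {L : List (Finset ι)} (h : IsLayering dep I L) :
    rightPart dep I L = [] := by
  classical
  cases L with
  | nil => rfl
  | cons K L =>
    rw [rightPart, if_pos]
    rw [Finset.filter_eq_empty_iff]
    exact fun f hf hn => hn (h.2.2.1 f hf)

theorem IsLayering.leftPart {I J : Finset ι} {L : List (Finset ι)} (h : IsLayering dep J L) :
    IsLayering dep I (leftPart dep I L) := by
  classical
  induction L generalizing I J with
  | nil => trivial
  | cons K L ih =>
    rw [LLL.leftPart]
    split_ifs with he
    · trivial
    · exact ⟨Finset.nonempty_iff_ne_empty.2 he, h.2.1.subset (Finset.filter_subset _ _),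
        fun f hf => (Finset.mem_filter.1 hf).2, ih h.2.2.2⟩

theorem IsLayering.rightPart {I J : Finset ι} {L : List (Finset ι)}
    (h : IsLayering dep (I ∪ J) L) : IsLayering dep J (rightPart dep I L) := by
  classical
  induction L generalizing I J with
  | nil => trivial
  | cons K L ih =>
    rw [LLL.rightPart]
    split_ifs with he
    · trivial
    · refine ⟨Finset.nonempty_iff_ne_empty.2 he, h.2.1.subset (Finset.filter_subset _ _),
        fun f hf => ?_, ih ?_⟩
      · obtain ⟨hK, hn⟩ := Finset.mem_filter.1 hf
        obtain ⟨g, hg, hd⟩ := h.2.2.1 f hK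
        rcases Finset.mem_union.1 hg with hg | hg
        · exact absurd ⟨g, hg, hd⟩ hn
        · exact ⟨g, hg, hd⟩
      · convert h.2.2.2 using 1
        exact Finset.filter_union_filter_not_eq _ _

theorem mergeLayers_parts {I J : Finset ι} {L : List (Finset ι)}
    (h : IsLayering dep J L) :
    mergeLayers (leftPart dep I L) (rightPart dep I L) = L := by
  classical
  induction L generalizing I J with
  | nil => rfl
  | cons K L ih =>
    have hK := Finset.filter_union_filter_not_eq (fun f => Touches dep f I) K
    have ih := @ih (K.filter fun f => Touches dep f I) K h.2.2.2
    rw [leftPart, rightPart]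
    split_ifs with h1 h2 h2
    · rw [h1, h2, Finset.empty_union] at hK
      exact absurd hK.symm (Finset.nonempty_iff_ne_empty.1 h.1)
    · rw [h1, Finset.empty_union] at hK
      rw [h1, leftPart_empty] at ih
      rw [mergeLayers, h1, hK]
      exact congrArg _ ih
    · rw [h2, Finset.union_empty] at hK
      rw [hK, rightPart_self h.2.2.2, mergeLayers_nil] at ih
      rw [mergeLayers_nil, hK, ih]
    · rw [mergeLayers, hK, ih]

/-- The weight of a list of layers. -/
def layersWeight (γ : ι → ℝ≥0∞) (L : List (Finset ι)) : ℝ≥0∞ :=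
  (L.map fun I => ∏ f ∈ I, γ f).prod

theorem layersWeight_cons (γ : ι → ℝ≥0∞) (I : Finset ι) (L : List (Finset ι)) :
    layersWeight γ (I :: L) = (∏ f ∈ I, γ f) * layersWeight γ L := by
  simp [layersWeight]

theorem layersWeight_parts (γ : ι → ℝ≥0∞) {I J : Finset ι} {L : List (Finset ι)}
    (h : IsLayering dep J L) :
    layersWeight γ (leftPart dep I L) * layersWeight γ (rightPart dep I L) =
      layersWeight γ L := by
  classical
  induction L generalizing I J with
  | nil => simp [leftPart, rightPart, layersWeight]
  | cons K L ih =>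
    have hK := Finset.prod_filter_mul_prod_filter_not K (fun f => Touches dep f I) γ
    have hK' := Finset.filter_union_filter_not_eq (fun f => Touches dep f I) K
    have ih := @ih (K.filter fun f => Touches dep f I) K h.2.2.2
    rw [leftPart, rightPart]
    split_ifs with h1 h2 h2
    · rw [h1, h2, Finset.empty_union] at hK'
      exact absurd hK'.symm (Finset.nonempty_iff_ne_empty.1 h.1)
    · rw [h1, leftPart_empty] at ih
      rw [h1] at hK
      simp only [layersWeight_cons, ← ih, ← hK, h1]
      simp [layersWeight]
    · rw [h2, Finset.union_empty] at hK'
      rw [hK', rightPart_self h.2.2.2] at ih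
      simp only [layersWeight_cons, hK']
      rw [← ih]
      simp [layersWeight]
    · simp only [layersWeight_cons, ← ih, ← hK]
      ring

variable (dep) in
/-- The total weight of the layerings with first layer `I`. -/
def layerSum (γ : ι → ℝ≥0∞) (I : Finset ι) : ℝ≥0∞ :=
  (∏ f ∈ I, γ f) * ∑' L : {L // IsLayering dep I L}, layersWeight γ L.1

/-- Splitting a layering into what is reachable from `I` and the rest is injective, since merging
recovers it, and multiplicative in the weight. -/
theorem layerSum_union_le (γ : ι → ℝ≥0∞) {I J : Finset ι} (hd : Disjoint I J) :
    layerSum dep γ (I ∪ J) ≤ layerSum dep γ I * layerSum dep γ J := by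
  rw [layerSum, layerSum, layerSum, Finset.prod_union hd, mul_mul_mul_comm]
  gcongr
  let e : {L // IsLayering dep (I ∪ J) L} →
      {L // IsLayering dep I L} × {L // IsLayering dep J L} :=
    fun L => (⟨_, L.2.leftPart⟩, ⟨_, L.2.rightPart⟩)
  have he : Function.Injective e := by
    intro L L' h
    have h1 := congrArg (fun p => mergeLayers p.1.1 p.2.1) h
    simp only [e] at h1
    rw [mergeLayers_parts L.2, mergeLayers_parts L'.2] at h1
    exact Subtype.ext h1
  have hp : (∑' L : {L // IsLayering dep I L}, layersWeight γ L.1) *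
      (∑' L : {L // IsLayering dep J L}, layersWeight γ L.1) =
      ∑' p : {L // IsLayering dep I L} × {L // IsLayering dep J L},
        layersWeight γ p.1.1 * layersWeight γ p.2.1 := by
    rw [← ENNReal.tsum_mul_right, ENNReal.tsum_prod']
    simp_rw [ENNReal.tsum_mul_left]
  rw [hp]
  calc ∑' L : {L // IsLayering dep (I ∪ J) L}, layersWeight γ L.1
      = ∑' L, (fun p : {L // IsLayering dep I L} × {L // IsLayering dep J L} =>
        layersWeight γ p.1.1 * layersWeight γ p.2.1) (e L) :=
        tsum_congr fun L => (layersWeight_parts γ L.2).symm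
    _ ≤ _ := ENNReal.tsum_comp_le_tsum_of_injective he _

theorem layerSum_empty (γ : ι → ℝ≥0∞) : layerSum dep γ ∅ = 1 := by
  rw [layerSum, tsum_eq_single ⟨[], trivial⟩ fun L hL => absurd (Subtype.ext L.2.eq_nil) hL]
  simp [layersWeight]

theorem layerSum_le_prod (γ : ι → ℝ≥0∞) (I : Finset ι) :
    layerSum dep γ I ≤ ∏ f ∈ I, layerSum dep γ {f} := by
  induction I using Finset.induction_on with
  | empty => simp [layerSum_empty]
  | insert f I hf ih =>
    rw [Finset.prod_insert hf, Finset.insert_eq]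
    exact (layerSum_union_le γ (Finset.disjoint_singleton_left.2 hf)).trans (by gcongr)

end Layers

/-! ### The witness DAG of a layering -/

section LayeredWdag

set_option linter.unusedSectionVars false

variable {ι : Type} [DecidableEq ι] {dep : ι → ι → Prop}

/-- The nodes that remain after removing the sinks `k` times. -/
def Wdag.peel (H : Wdag dep) : ℕ → Set (Fin H.size)
  | 0 => Set.univ
  | k + 1 => {v | v ∈ H.peel k ∧ ∃ w ∈ H.peel k, H.edge v w}

theorem Wdag.mem_peel_of_iso {G H : Wdag dep} {e : Fin G.size ≃ Fin H.size}
    (he : ∀ v w, H.edge (e v) (e w) ↔ G.edge v w) (k : ℕ) (v : Fin G.size) :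
    e v ∈ H.peel k ↔ v ∈ G.peel k := by
  induction k generalizing v with
  | zero => simp [peel]
  | succ k ih =>
    refine and_congr (ih v) ⟨fun ⟨w, hw, h⟩ => ⟨e.symm w, ?_, ?_⟩,
      fun ⟨w, hw, h⟩ => ⟨e w, (ih w).2 hw, (he v w).2 h⟩⟩
    · rwa [← ih, e.apply_symm_apply]
    · rwa [← he, e.apply_symm_apply]

/-- The labels of the sinks that are left after removing the sinks `k` times. -/
def Wdag.peelLabels (H : Wdag dep) (k : ℕ) : Set ι :=
  H.label '' (H.peel k \ H.peel (k + 1))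

theorem Wdag.peelLabels_subset_of_iso {G H : Wdag dep} (h : G.Iso H) (k : ℕ) :
    G.peelLabels k ⊆ H.peelLabels k := by
  obtain ⟨e, hl, he⟩ := h
  rintro _ ⟨v, ⟨hv, hv'⟩, rfl⟩
  exact ⟨e v, ⟨(mem_peel_of_iso he k v).2 hv, fun hc => hv' ((mem_peel_of_iso he _ v).1 hc)⟩,
    hl v⟩

theorem Wdag.peelLabels_eq_of_iso {G H : Wdag dep} (h : G ≈ H) (k : ℕ) :
    G.peelLabels k = H.peelLabels k :=
  Set.Subset.antisymm (peelLabels_subset_of_iso h k) (peelLabels_subset_of_iso (Setoid.symm h) k)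

/-- The elements of a list of layers, each with the position of its layer. -/
def layerNodes (M : List (Finset ι)) : Finset (Σ _ : ℕ, ι) :=
  (Finset.range M.length).sigma fun k => M.getD k ∅

theorem mem_layerNodes {M : List (Finset ι)} {p : Σ _ : ℕ, ι} :
    p ∈ layerNodes M ↔ p.2 ∈ M.getD p.1 ∅ := by
  rw [layerNodes, Finset.mem_sigma, Finset.mem_range, and_iff_right_iff_imp]
  intro h
  by_contra hk
  rw [List.getD_eq_default _ _ (not_lt.1 hk)] at h
  simp at h

theorem prod_layerNodes (γ : ι → ℝ≥0∞) (M : List (Finset ι)) :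
    ∏ p ∈ layerNodes M, γ p.2 = layersWeight γ M := by
  rw [layerNodes, Finset.prod_sigma]
  induction M with
  | nil => simp [layersWeight]
  | cons I M ih =>
    rw [layersWeight_cons, ← ih, List.length_cons, Finset.prod_range_succ']
    simp [mul_comm]

def layerNodesEquiv (M : List (Finset ι)) : Fin (layerNodes M).card ≃ layerNodes M :=
  (layerNodes M).equivFin.symm

/-- Edges lead from later to earlier layers. -/
def layeredWdag (hs : ∀ f g, dep f g → dep g f) (M : List (Finset ι))
    (hM : ∀ K ∈ M, Indep dep K) : Wdag dep where
  size := (layerNodes M).card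
  label v := (layerNodesEquiv M v).1.2
  edge v w := (layerNodesEquiv M w).1.1 < (layerNodesEquiv M v).1.1 ∧
    dep (layerNodesEquiv M v).1.2 (layerNodesEquiv M w).1.2
  acyclic v hv := by
    have key : ∀ w, Relation.TransGen (fun v w =>
        (layerNodesEquiv M w).1.1 < (layerNodesEquiv M v).1.1 ∧
          dep (layerNodesEquiv M v).1.2 (layerNodesEquiv M w).1.2) v w →
        (layerNodesEquiv M w).1.1 < (layerNodesEquiv M v).1.1 := by
      intro w hw
      induction hw with
      | single h => exact h.1
      | tail _ h ih => exact h.1.trans ih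
    exact lt_irrefl _ (key v hv)
  edge_iff v w hvw := by
    refine ⟨fun h => h.elim (fun h => h.2) fun h => hs _ _ h.2, fun h => ?_⟩
    rcases lt_trichotomy (layerNodesEquiv M v).1.1 (layerNodesEquiv M w).1.1 with hlt | heq | hlt
    · exact Or.inr ⟨hlt, hs _ _ h⟩
    · exfalso
      have hv := mem_layerNodes.1 (layerNodesEquiv M v).2
      have hw := mem_layerNodes.1 (layerNodesEquiv M w).2
      rw [← heq] at hw
      have hlen : (layerNodesEquiv M v).1.1 < M.length :=
        Finset.mem_range.1 (Finset.mem_sigma.1 (layerNodesEquiv M v).2).1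
      rw [List.getD_eq_getElem _ _ hlen] at hv hw
      refine hM _ (List.getElem_mem hlen) _ hv _ hw (fun hl => hvw ?_) h
      exact (layerNodesEquiv M).injective (Subtype.ext (Sigma.ext heq (heq_of_eq hl)))
    · exact Or.inl ⟨hlt, h⟩

variable {hs : ∀ f g, dep f g → dep g f} {M : List (Finset ι)} {hM : ∀ K ∈ M, Indep dep K}

theorem layeredWdag_weight (γ : ι → ℝ≥0∞) :
    (layeredWdag hs M hM).weight γ = layersWeight γ M := by
  rw [← prod_layerNodes, ← Finset.prod_coe_sort]
  exact Fintype.prod_equiv (layerNodesEquiv M) _ _ fun v => rfl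

theorem IsLayering.touches_getD {I : Finset ι} {L : List (Finset ι)} (h : IsLayering dep I L)
    (k : ℕ) {f : ι} (hf : f ∈ (I :: L).getD (k + 1) ∅) :
    Touches dep f ((I :: L).getD k ∅) := by
  induction L generalizing I k with
  | nil => simp at hf
  | cons K L ih =>
    cases k with
    | zero => exact h.2.2.1 f hf
    | succ k => exact ih h.2.2.2 k hf

theorem IsLayering.indep {I : Finset ι} {L : List (Finset ι)} (h : IsLayering dep I L)
    (hI : Indep dep I) : ∀ K ∈ I :: L, Indep dep K := by
  induction L generalizing I with
  | nil => simpa using hI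
  | cons J L ih =>
    intro K hK
    rcases List.mem_cons.1 hK with rfl | hK
    · exact hI
    · exact ih h.2.2.2 h.2.1 K hK

/-- Each node outside the first layer has an edge into the layer just before its own, so every
peeling removes exactly one layer. -/
theorem layeredWdag_mem_peel {I : Finset ι} {L : List (Finset ι)} (h : IsLayering dep I L)
    {hM : ∀ K ∈ I :: L, Indep dep K} (k : ℕ) (v : Fin (layeredWdag hs (I :: L) hM).size) :
    v ∈ (layeredWdag hs (I :: L) hM).peel k ↔ k ≤ (layerNodesEquiv (I :: L) v).1.1 := by
  induction k generalizing v with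
  | zero => simp [Wdag.peel]
  | succ k ih =>
    constructor
    · rintro ⟨-, w, hw, he, -⟩
      exact lt_of_le_of_lt ((ih w).1 hw) he
    · intro hk
      refine ⟨(ih v).2 (by omega), ?_⟩
      have hv := mem_layerNodes.1 (layerNodesEquiv (I :: L) v).2
      obtain ⟨m, hm⟩ : ∃ m, (layerNodesEquiv (I :: L) v).1.1 = m + 1 :=
        Nat.exists_eq_succ_of_ne_zero (by omega)
      rw [hm] at hv
      obtain ⟨g, hg, hd⟩ := h.touches_getD m hv
      have hmem : (⟨m, g⟩ : Σ _ : ℕ, ι) ∈ layerNodes (I :: L) := mem_layerNodes.2 hg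
      refine ⟨(layerNodesEquiv (I :: L)).symm ⟨_, hmem⟩, (ih _).2 ?_, ?_, ?_⟩
      · rw [Equiv.apply_symm_apply]
        show k ≤ m
        omega
      · rw [Equiv.apply_symm_apply, hm]
        exact Nat.lt_succ_self m
      · rw [Equiv.apply_symm_apply]
        exact hd

theorem layeredWdag_peelLabels {I : Finset ι} {L : List (Finset ι)} (h : IsLayering dep I L)
    {hM : ∀ K ∈ I :: L, Indep dep K} (k : ℕ) :
    (layeredWdag hs (I :: L) hM).peelLabels k = (I :: L).getD k ∅ := by
  ext f
  simp only [Wdag.peelLabels, Set.mem_image, Set.mem_sdiff, layeredWdag_mem_peel h]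
  constructor
  · rintro ⟨v, ⟨h1, h2⟩, rfl⟩
    have hv := mem_layerNodes.1 (layerNodesEquiv (I :: L) v).2
    rwa [show (layerNodesEquiv (I :: L) v).1.1 = k by omega] at hv
  · intro hf
    have hmem : (⟨k, f⟩ : Σ _ : ℕ, ι) ∈ layerNodes (I :: L) := mem_layerNodes.2 hf
    refine ⟨(layerNodesEquiv (I :: L)).symm ⟨_, hmem⟩, ?_, ?_⟩
    · rw [Equiv.apply_symm_apply]
      simp
    · show (layerNodesEquiv (I :: L) _).1.2 = f
      rw [Equiv.apply_symm_apply]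

theorem Wdag.sinks_eq_peelLabels (H : Wdag dep) : H.sinks = H.peelLabels 0 := by
  ext f
  simp only [sinks, peelLabels, peel, Set.mem_ofPred_eq, Set.mem_image, Set.mem_sdiff, Set.mem_univ,
    true_and, not_exists]
  exact exists_congr fun v => and_comm

/-- Layers are nonempty, so the default value `∅` marks the end of the list. -/
theorem IsLayering.eq_of_getD {I I' : Finset ι} {L L' : List (Finset ι)} (h : IsLayering dep I L)
    (h' : IsLayering dep I' L') (hk : ∀ k, L.getD k ∅ = L'.getD k ∅) : L = L' := by
  induction L generalizing I I' L' with
  | nil =>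
    cases L' with
    | nil => rfl
    | cons J L' => exact absurd (hk 0).symm (Finset.nonempty_iff_ne_empty.1 h'.1)
  | cons K L ih =>
    cases L' with
    | nil => exact absurd (hk 0) (Finset.nonempty_iff_ne_empty.1 h.1)
    | cons J L' =>
      rw [show K = J from hk 0, ih h.2.2.2 h'.2.2.2 fun k => hk (k + 1)]

theorem indep_singleton (f : ι) : Indep dep {f} := by
  intro a ha b hb hab
  rw [Finset.mem_singleton] at ha hb
  exact absurd (ha.trans hb.symm) hab

/-- Peeling off sinks is invariant under isomorphism and recovers the layers, so distinct layerings
give non-isomorphic witness DAGs. -/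
theorem layerSum_singleton_le_Psi (hs : ∀ f g, dep f g → dep g f) (γ : ι → ℝ≥0∞) (f : ι) :
    layerSum dep γ {f} ≤ Psi dep γ {f} := by
  let e : {L // IsLayering dep {f} L} → {H : WdagClass dep // H.sinks = {f}} := fun L =>
    ⟨⟦layeredWdag hs ({f} :: L.1) (L.2.indep (indep_singleton f))⟧, by
      show Wdag.sinks _ = _
      rw [Wdag.sinks_eq_peelLabels, layeredWdag_peelLabels L.2]
      simp⟩
  have he : Function.Injective e := by
    intro L L' h
    have hiso := Quotient.exact (congrArg Subtype.val h)
    refine Subtype.ext (L.2.eq_of_getD L'.2 fun k => ?_)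
    have := Wdag.peelLabels_eq_of_iso hiso (k + 1)
    rw [layeredWdag_peelLabels L.2, layeredWdag_peelLabels L'.2] at this
    exact_mod_cast this
  rw [layerSum, ← ENNReal.tsum_mul_left]
  calc ∑' L : {L // IsLayering dep {f} L}, (∏ g ∈ {f}, γ g) * layersWeight γ L.1
      = ∑' L, (fun H : {H : WdagClass dep // H.sinks = {f}} => H.1.weight γ) (e L) := by
        refine tsum_congr fun L => ?_
        rw [← layersWeight_cons, ← layeredWdag_weight]
        rfl
    _ ≤ Psi dep γ {f} := ENNReal.tsum_comp_le_tsum_of_injective he _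

end LayeredWdag

/-! ### Bounding the hitting probability by a potential -/

section Potential

variable {Ω : Type} {R : ResamplingOracle Ω}

open Classical in
/-- The potential of a history: `1` once `E` has been visited, and `U` of the current state
before that. -/
def historyPotential (E : Set Ω) (U : Ω → ℝ≥0∞) (h : History R) : ℝ≥0∞ :=
  if h.Visits E then 1 else U h.current

theorem tsum_bind_mul {α β : Type} (p : PMF α) (q : α → PMF β) (F : β → ℝ≥0∞) :
    ∑' b, p.bind q b * F b = ∑' a, p a * ∑' b, q a b * F b := by
  simp_rw [PMF.bind_apply, ← ENNReal.tsum_mul_right, ← ENNReal.tsum_mul_left]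
  rw [ENNReal.tsum_comm]
  simp_rw [mul_assoc]

theorem tsum_pure_mul {α : Type} (a : α) (F : α → ℝ≥0∞) :
    ∑' b, PMF.pure a b * F b = F a := by
  classical
  rw [tsum_eq_single a fun b hb => by simp [PMF.pure_apply, hb]]
  simp

theorem tsum_map_mul {α β : Type} (p : PMF α) (q : α → β) (F : β → ℝ≥0∞) :
    ∑' b, p.map q b * F b = ∑' a, p a * F (q a) := by
  rw [PMF.map, tsum_bind_mul]
  simp_rw [Function.comp_apply, tsum_pure_mul]

variable {E : Set Ω} {U : Ω → ℝ≥0∞}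

/-- The supermartingale property. At the first visit to `E` the potential is reset from `U` to `1`,
which is a decrease by `hE`; the selection is averaged out because the bound holds for each flaw
that may be selected. -/
theorem tsum_step_potential_le (hE : ∀ σ ∈ E, 1 ≤ U σ)
    (hU : ∀ (f : R.flaws), ∀ σ ∈ (f : Set Ω), ∑' τ, R.resample f σ τ * U τ ≤ U σ)
    (S : SelectionRule R) (h : History R) :
    ∑' h', S.step h h' * historyPotential E U h' ≤ historyPotential E U h := by
  unfold SelectionRule.step
  split_ifs with hf
  · rw [tsum_bind_mul]
    simp_rw [tsum_map_mul]
    have key : ∀ f ∈ (S.select h hf).support,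
        ∑' τ, R.resample f h.current τ *
          historyPotential E U (⟨h.init, (f, τ) :: h.steps⟩ : History R) ≤
          historyPotential E U h := by
      intro f hfs
      by_cases hv : h.Visits E
      · have : ∀ τ, historyPotential E U (⟨h.init, (f, τ) :: h.steps⟩ : History R) = 1 := by
          intro τ
          refine if_pos ?_
          rcases hv with hv | ⟨p, hp, hv⟩
          · exact Or.inl hv
          · exact Or.inr ⟨p, List.mem_cons_of_mem _ hp, hv⟩
        simp_rw [this, mul_one, PMF.tsum_coe]
        rw [historyPotential, if_pos hv]
      · rw [historyPotential, if_neg hv]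
        refine le_trans (ENNReal.tsum_le_tsum fun τ => ?_) (hU f _ (S.select_holds h hf f hfs))
        gcongr
        rw [historyPotential]
        split_ifs with hv'
        · rcases hv' with hv' | ⟨p, hp, hv'⟩
          · exact absurd (Or.inl hv') hv
          · rcases List.mem_cons.1 hp with rfl | hp
            · exact hE _ hv'
            · exact absurd (Or.inr ⟨p, hp, hv'⟩) hv
        · exact le_rfl
    calc _ ≤ ∑' f, S.select h hf f * historyPotential E U h := by
          refine ENNReal.tsum_le_tsum fun f => ?_
          by_cases hfs : f ∈ (S.select h hf).support
          · gcongr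
            exact key f hfs
          · rw [PMF.mem_support_iff, not_not] at hfs
            simp [hfs]
      _ = historyPotential E U h := by rw [ENNReal.tsum_mul_right, PMF.tsum_coe, one_mul]
  · rw [tsum_pure_mul]

theorem hitProb_le_of_potential (hE : ∀ σ ∈ E, 1 ≤ U σ)
    (hU : ∀ (f : R.flaws), ∀ σ ∈ (f : Set Ω), ∑' τ, R.resample f σ τ * U τ ≤ U σ)
    (S : SelectionRule R) (μ : PMF Ω) :
    S.hitProb μ E ≤ ∑' σ, μ σ * U σ := by
  have hrun : ∀ t, ∑' h, S.run μ t h * historyPotential E U h ≤ ∑' σ, μ σ * U σ := by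
    intro t
    induction t with
    | zero =>
      rw [SelectionRule.run, tsum_map_mul]
      refine ENNReal.tsum_le_tsum fun σ => ?_
      gcongr
      rw [historyPotential]
      split_ifs with hv
      · refine hE σ ?_
        rcases hv with hv | ⟨p, hp, -⟩
        · exact hv
        · simp at hp
      · exact le_rfl
    | succ t ih =>
      rw [SelectionRule.run, tsum_bind_mul]
      refine le_trans (ENNReal.tsum_le_tsum fun h => ?_) ih
      gcongr
      exact tsum_step_potential_le hE hU S h
  refine iSup_le fun t => le_trans ?_ (hrun t)
  rw [PMF.toOuterMeasure_apply]
  refine ENNReal.tsum_le_tsum fun h => ?_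
  by_cases hv : h.Visits E
  · rw [Set.indicator_of_mem (by exact hv), historyPotential, if_pos hv, mul_one]
  · rw [Set.indicator_of_notMem (by exact hv)]
    exact zero_le

end Potential

/-! ### Partial permutations -/

section Perm

open Equiv

variable {n : ℕ}

/-- Some permutation satisfies both atomic events. -/
def Compat (p q : Fin n × Fin n) : Prop := p.1 = q.1 ↔ p.2 = q.2

theorem Compat.symm {p q : Fin n × Fin n} (h : Compat p q) : Compat q p := by
  unfold Compat at *
  rw [eq_comm, h, eq_comm]

theorem Compat.refl (p : Fin n × Fin n) : Compat p p := by simp [Compat]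

def Consistent (C : Set (Fin n × Fin n)) : Prop := ∀ p ∈ C, ∀ q ∈ C, Compat p q

/-- The permutations that satisfy all atomic events in `C`. -/
def cylinder (C : Set (Fin n × Fin n)) : Set (Perm (Fin n)) := {σ | ∀ p ∈ C, σ p.1 = p.2}

theorem compat_of_mem_cylinder {C : Set (Fin n × Fin n)} {σ : Perm (Fin n)}
    (h : σ ∈ cylinder C) {p q : Fin n × Fin n} (hp : p ∈ C) (hq : q ∈ C) : Compat p q := by
  rw [Compat, ← h p hp, ← h q hq, σ.injective.eq_iff]

/-- The atomic events that must hold before `g` is resampled, in order that those of `C` can hold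
afterwards. -/
def reduce (C : Set (Fin n × Fin n)) (g : Fin n × Fin n) : Set (Fin n × Fin n) :=
  {p | p = g ∨ (p ∈ C ∧ p.1 ≠ g.1 ∧ p.2 ≠ g.2) ∨
    ((g.1, p.2) ∈ C ∧ (p.1, g.2) ∈ C ∧ p.1 ≠ g.1 ∧ p.2 ≠ g.2)}

theorem Consistent.reduce {C : Set (Fin n × Fin n)} (hC : Consistent C) (g : Fin n × Fin n) :
    Consistent (reduce C g) := by
  rintro ⟨x, y⟩ hp ⟨x', y'⟩ hq
  simp only [LLL.reduce, Set.mem_ofPred_eq] at hp hq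
  have h : ∀ x y x' y', (x, y) ∈ C → (x', y') ∈ C → (x = x' ↔ y = y') :=
    fun x y x' y' h h' => hC _ h _ h'
  obtain ⟨a, b⟩ := g
  simp only [Prod.mk.injEq, Compat] at *
  grind

theorem subset_reduce {C : Set (Fin n × Fin n)} {g : Fin n × Fin n}
    (h : ∀ p ∈ C, Compat g p) : C ⊆ reduce C g := by
  intro p hp
  have := h p hp
  unfold Compat at this
  by_cases hpg : p = g
  · exact Or.inl hpg
  · refine Or.inr (Or.inl ⟨hp, fun h1 => ?_, fun h2 => ?_⟩)
    · exact hpg (Prod.ext h1 (this.1 h1.symm).symm)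
    · exact hpg (Prod.ext (this.2 h2.symm).symm h2)

/-- `n` times the transition matrix of the atomic event `p`. -/
def atomMatrix (p : Fin n × Fin n) : Matrix (Perm (Fin n)) (Perm (Fin n)) ℝ≥0∞ :=
  Matrix.of fun σ τ => if σ p.1 = p.2 then ∑ z, if swap p.2 z * σ = τ then 1 else 0 else 0

open Matrix

theorem atomMatrix_mulVec (p : Fin n × Fin n) (v : Perm (Fin n) → ℝ≥0∞) (σ : Perm (Fin n)) :
    (atomMatrix p *ᵥ v) σ = if σ p.1 = p.2 then ∑ z, v (swap p.2 z * σ) else 0 := by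
  simp only [mulVec, dotProduct, atomMatrix, of_apply]
  split_ifs
  · simp_rw [Finset.sum_mul, ite_mul, one_mul, zero_mul]
    rw [Finset.sum_comm]
    simp
  · simp

def cylinderIndicator (C : Set (Fin n × Fin n)) : Perm (Fin n) → ℝ≥0∞ :=
  (cylinder C).indicator 1

/-- The swap cannot make an event of `C` true: the only value newly placed at a point other than
`g.1` is `g.2`, and an event with value `g.2` that is compatible with `g` is `g` itself. -/
theorem swap_mul_mem_cylinder_iff {C : Set (Fin n × Fin n)} {g : Fin n × Fin n}
    (h : ∀ p ∈ C, Compat g p) {σ : Perm (Fin n)} (hσ : σ g.1 = g.2) (z : Fin n) :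
    swap g.2 z * σ ∈ cylinder C ↔ σ ∈ cylinder C ∧ ∀ p ∈ C, swap g.2 z p.2 = p.2 := by
  have key : ∀ p ∈ C, swap g.2 z (σ p.1) = p.2 → σ p.1 = p.2 := by
    intro p hp hs
    have hc := h p hp
    unfold Compat at hc
    by_cases h1 : g.1 = p.1
    · rw [← h1, hσ, hc.1 h1]
    · have h2 : g.2 ≠ p.2 := fun h2 => h1 (hc.2 h2)
      have h3 : σ p.1 ≠ g.2 := fun h3 => h1 (σ.injective (hσ.trans h3.symm))
      by_cases h4 : σ p.1 = z
      · rw [h4, swap_apply_right] at hs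
        exact absurd hs h2
      · rwa [swap_apply_of_ne_of_ne h3 h4] at hs
  simp only [cylinder, Set.mem_ofPred_eq, Perm.mul_apply]
  constructor
  · intro hs
    have h1 : ∀ p ∈ C, σ p.1 = p.2 := fun p hp => key p hp (hs p hp)
    exact ⟨h1, fun p hp => by rw [← h1 p hp]; rw [hs p hp, h1 p hp]⟩
  · rintro ⟨h1, h2⟩ p hp
    rw [h1 p hp, h2 p hp]

theorem mem_cylinder_reduce_iff {C : Set (Fin n × Fin n)} {g : Fin n × Fin n}
    (h : ∀ p ∈ C, Compat g p) {σ : Perm (Fin n)} :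
    σ ∈ cylinder (reduce C g) ↔ σ g.1 = g.2 ∧ σ ∈ cylinder C := by
  constructor
  · exact fun hσ => ⟨hσ g (Or.inl rfl), fun p hp => hσ p (subset_reduce h hp)⟩
  · rintro ⟨h1, h2⟩ p (rfl | ⟨hp, -⟩ | ⟨hp, -, -, hne⟩)
    · exact h1
    · exact h2 p hp
    · exact absurd ((h _ hp).1 rfl).symm hne

theorem swap_mul_mem_cylinder_iff_of_fst {C : Set (Fin n × Fin n)} (hC : Consistent C)
    {g : Fin n × Fin n} {y : Fin n} (hy : (g.1, y) ∈ C) (hyg : y ≠ g.2) {σ : Perm (Fin n)}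
    (hσ : σ g.1 = g.2) (z : Fin n) :
    swap g.2 z * σ ∈ cylinder C ↔ z = y ∧ σ ∈ cylinder (reduce C g) := by
  obtain ⟨a, b⟩ := g
  have hC : ∀ x y x' y', (x, y) ∈ C → (x', y') ∈ C → (x = x' ↔ y = y') :=
    fun x y x' y' h h' => hC _ h _ h'
  have hinj : ∀ x x', σ x = σ x' → x = x' := fun x x' h => σ.injective h
  simp only [cylinder, reduce, Set.mem_ofPred_eq, Perm.mul_apply, Prod.forall, Prod.mk.injEq]
    at *
  constructor
  · intro hs
    have hz : z = y := by
      have := hs a y hy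
      rwa [hσ, swap_apply_left] at this
    subst hz
    refine ⟨rfl, fun x' y' => ?_⟩
    rintro (⟨rfl, rfl⟩ | ⟨h1, h2, h3⟩ | ⟨h1, h2, h3, h4⟩)
    · exact hσ
    · have := hs _ _ h1
      rw [swap_apply_def] at this
      grind
    · have := hs _ _ h2
      rw [swap_apply_def] at this
      grind
  · rintro ⟨rfl, hs⟩ x' y' hp
    have h1 := hs x' z
    rw [swap_apply_def]
    grind

/-- The value `g.2` has to move to `x`, which forces `z = σ x`. By `hn` the third clause of `reduce`
is void here: `C` prescribes no value at `g.1`. -/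
theorem swap_mul_mem_cylinder_iff_of_snd {C : Set (Fin n × Fin n)} (hC : Consistent C)
    {g : Fin n × Fin n} {x : Fin n} (hx : (x, g.2) ∈ C) (hxg : x ≠ g.1)
    (hn : ∀ y, (g.1, y) ∉ C) {σ : Perm (Fin n)} (hσ : σ g.1 = g.2) (z : Fin n) :
    swap g.2 z * σ ∈ cylinder C ↔ z = σ x ∧ σ ∈ cylinder (reduce C g) := by
  obtain ⟨a, b⟩ := g
  have hC : ∀ x y x' y', (x, y) ∈ C → (x', y') ∈ C → (x = x' ↔ y = y') :=
    fun x y x' y' h h' => hC _ h _ h'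
  have hinj : ∀ x x', σ x = σ x' → x = x' := fun x x' h => σ.injective h
  simp only [cylinder, reduce, Set.mem_ofPred_eq, Perm.mul_apply, Prod.forall, Prod.mk.injEq]
    at *
  constructor
  · intro hs
    have hz : z = σ x := by
      have := hs x b hx
      rw [swap_apply_def] at this
      grind
    refine ⟨hz, fun x' y' => ?_⟩
    rintro (⟨rfl, rfl⟩ | ⟨h1, h2, h3⟩ | ⟨h1, h2, h3, h4⟩)
    · exact hσ
    · have := hs _ _ h1
      rw [swap_apply_def] at this
      grind
    · exact absurd h1 (hn _)
  · rintro ⟨rfl, hs⟩ x' y' hp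
    rw [swap_apply_def]
    grind

theorem atomMatrix_mulVec_indicator {C : Set (Fin n × Fin n)} (hC : Consistent C)
    (g : Fin n × Fin n) :
    ∃ c : ℝ≥0∞, atomMatrix g *ᵥ cylinderIndicator C = c • cylinderIndicator (reduce C g) := by
  classical
  have hself : ∀ σ : Perm (Fin n), σ g.1 ≠ g.2 → σ ∉ cylinder (reduce C g) :=
    fun σ hσ h => hσ (h g (Or.inl rfl))
  by_cases h : ∀ p ∈ C, Compat g p
  -- Without a conflict, the constant counts the `z` that leave all events of `C` true; it does not
  -- depend on `σ`.
  · refine ⟨∑ z : Fin n, if ∀ p ∈ C, swap g.2 z p.2 = p.2 then 1 else 0, funext fun σ => ?_⟩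
    rw [atomMatrix_mulVec, Pi.smul_apply, smul_eq_mul]
    split_ifs with hσ
    · simp only [cylinderIndicator, Set.indicator_apply, swap_mul_mem_cylinder_iff h hσ,
        mem_cylinder_reduce_iff h, hσ, true_and, Pi.one_apply]
      by_cases hm : σ ∈ cylinder C <;> simp [hm]
    · simp [cylinderIndicator, hself σ hσ]
  -- With a conflict, exactly one `z` leads from a state of the reduced cylinder into `C`.
  · refine ⟨1, funext fun σ => ?_⟩
    rw [atomMatrix_mulVec, one_smul]
    split_ifs with hσ
    · have key : ∀ w, (∀ z, swap g.2 z * σ ∈ cylinder C ↔ z = w ∧ σ ∈ cylinder (reduce C g)) →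
          ∑ z, cylinderIndicator C (swap g.2 z * σ) = cylinderIndicator (reduce C g) σ := by
        intro w hw
        simp only [cylinderIndicator, Set.indicator_apply, hw, Pi.one_apply]
        by_cases hm : σ ∈ cylinder (reduce C g) <;> simp [hm]
      by_cases hy : ∃ y, (g.1, y) ∈ C ∧ y ≠ g.2
      · obtain ⟨y, hy, hyg⟩ := hy
        exact key y (swap_mul_mem_cylinder_iff_of_fst hC hy hyg hσ)
      · push Not at h hy
        obtain ⟨⟨x, y⟩, hp, hc⟩ := h
        have hxy : x ≠ g.1 ∧ y = g.2 := by
          have := hy y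
          unfold Compat at hc
          grind
        obtain ⟨hx, rfl⟩ := hxy
        refine key (σ x) (swap_mul_mem_cylinder_iff_of_snd hC hp hx (fun y hy' => ?_) hσ)
        have h1 := hy y hy'
        subst h1
        exact hx ((hC _ hp _ hy').2 rfl)
    · simp [cylinderIndicator, hself σ hσ]

/-- Both products sum over pairs of swaps applied in a state where both events hold; the first swap
must not destroy the second event, whence the condition `zw.1 ≠ b'` in `key`. It remains to match
the pairs of the two orders. -/
theorem atomMatrix_commute {p q : Fin n × Fin n} (h : Compat p q) :
    Commute (atomMatrix p) (atomMatrix q) := by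
  by_cases hpq : p = q
  · rw [hpq]
  obtain ⟨a, b⟩ := p
  obtain ⟨a', b'⟩ := q
  unfold Compat at h
  have hb : b ≠ b' := fun hb => hpq (Prod.ext (h.2 hb) hb)
  have ha : a ≠ a' := fun ha => hb (h.1 ha)
  have key : ∀ a b a' b', a ≠ a' → b ≠ b' → ∀ (v : Perm (Fin n) → ℝ≥0∞) σ,
      ((atomMatrix (a, b) * atomMatrix (a', b')) *ᵥ v) σ =
      if σ a = b ∧ σ a' = b' then ∑ zw : Fin n × Fin n with zw.1 ≠ b',
        v (swap b' zw.2 * swap b zw.1 * σ) else 0 := by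
    intro a b a' b' ha hb v σ
    have hsw : σ a = b → ∀ z, (swap b z * σ) a' = b' ↔ σ a' = b' ∧ z ≠ b' := by
      intro hσ z
      have : σ a' ≠ σ a := fun h => ha (σ.injective h).symm
      rw [Perm.mul_apply, swap_apply_def]
      grind
    rw [← mulVec_mulVec, atomMatrix_mulVec]
    by_cases hσ : σ a = b
    · simp only [hσ, if_true, true_and, atomMatrix_mulVec, hsw hσ]
      by_cases hσ' : σ a' = b'
      · simp only [hσ', if_true, true_and]
        rw [Finset.sum_filter, Fintype.sum_prod_type]
        refine Finset.sum_congr rfl fun z _ => ?_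
        split_ifs <;> simp [mul_assoc]
      · simp [hσ']
    · simp [hσ]
  refine Matrix.ext_of_mulVec_single fun i => funext fun σ => ?_
  rw [key a b a' b' ha hb, key a' b' a b ha.symm hb.symm]
  simp only [and_comm (a := σ a' = b')]
  split_ifs
  -- For `w ≠ b`, moving `swap b z` past `swap b' w` by conjugation gives the pair `(w, swap b' w
  -- z)`. The outer `swap b _` in the first component changes it only for `w = b`, where the plain
  -- pair would violate the side condition.
  · refine Finset.sum_bij' (fun zw _ => (swap b (swap b' zw.2 zw.1) zw.2, swap b' zw.2 zw.1))
      (fun zw _ => (swap b' (swap b zw.2 zw.1) zw.2, swap b zw.2 zw.1)) ?_ ?_ ?_ ?_ ?_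
    · rintro ⟨z, w⟩ hz
      simp only [Finset.mem_filter, Finset.mem_univ, true_and, swap_apply_def] at hz ⊢
      grind
    · rintro ⟨z, w⟩ hz
      simp only [Finset.mem_filter, Finset.mem_univ, true_and, swap_apply_def] at hz ⊢
      grind
    · rintro ⟨z, w⟩ hz
      simp only [Finset.mem_filter, Finset.mem_univ, true_and, swap_apply_def] at hz ⊢
      grind
    · rintro ⟨z, w⟩ hz
      simp only [Finset.mem_filter, Finset.mem_univ, true_and, swap_apply_def] at hz ⊢
      grind
    · rintro ⟨z, w⟩ hz
      simp only [Finset.mem_filter, Finset.mem_univ, true_and] at hz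
      congr 2
      ext x
      simp only [Perm.mul_apply, swap_apply_def]
      grind
  · rfl

end Perm

section PermFlaws

open Equiv Matrix

variable {n : ℕ}

/-! ### The transition matrix of a flaw -/

/-- The transition matrix of the flaw with the given list of atomic events. -/
def listMatrix (K : List (Fin n × Fin n)) : Matrix (Perm (Fin n)) (Perm (Fin n)) ℝ≥0∞ :=
  Matrix.of fun σ τ => (cylinder {p | p ∈ K}).indicator (fun σ' => permResample K σ' τ) σ

def reduceList (K : List (Fin n × Fin n)) (C : Set (Fin n × Fin n)) : Set (Fin n × Fin n) :=
  K.foldr (fun p C => reduce C p) C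

/-- Lists of mutually compatible distinct atomic events. -/
def CompatList (K : List (Fin n × Fin n)) : Prop :=
  K.Pairwise fun p q => p.1 ≠ q.1 ∧ p.2 ≠ q.2

theorem CompatList.compat {K : List (Fin n × Fin n)} (hK : CompatList K) :
    ∀ p ∈ K, ∀ q ∈ K, Compat p q :=
  have : Std.Symm (Compat (n := n)) := ⟨fun _ _ h => h.symm⟩
  fun _ hp _ hq => List.Pairwise.forall_of_forall (R := Compat)
    (fun p _ => Compat.refl p) (hK.imp fun h => iff_of_false h.1 h.2) hp hq

theorem listMatrix_nil : listMatrix ([] : List (Fin n × Fin n)) = 1 := by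
  ext σ τ
  simp [listMatrix, cylinder, permResample, PMF.pure_apply, Matrix.one_apply, eq_comm]

/-- Restricting the draw to `Z` only changes the normalization: a `z` outside `Z` destroys some
event of `K`, and the corresponding row of `listMatrix K` vanishes. -/
theorem listMatrix_cons {p : Fin n × Fin n} {K : List (Fin n × Fin n)}
    (hK : CompatList (p :: K)) :
    ∃ c : ℝ≥0∞, listMatrix (p :: K) = c • (atomMatrix p * listMatrix K) := by
  set Z := Finset.univ.filter fun z : Fin n => ∀ q ∈ K, swap p.2 z q.2 = q.2 with hZ
  refine ⟨(Z.card : ℝ≥0∞)⁻¹, Matrix.ext_of_mulVec_single fun i => funext fun σ => ?_⟩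
  have hc : ∀ q ∈ K, Compat p q := fun q hq =>
    hK.compat p List.mem_cons_self q (List.mem_cons_of_mem _ hq)
  rw [smul_mulVec, ← mulVec_mulVec, Pi.smul_apply, atomMatrix_mulVec]
  by_cases hσ : σ p.1 = p.2
  · rw [if_pos hσ]
    by_cases hσK : σ ∈ cylinder {q | q ∈ K}
    · have hm : σ ∈ cylinder {q | q ∈ p :: K} := by
        intro q hq
        rcases List.mem_cons.1 hq with rfl | hq
        · exact hσ
        · exact hσK q hq
      have hz : ∀ z, swap p.2 z * σ ∈ cylinder {q | q ∈ K} ↔ z ∈ Z := by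
        intro z
        rw [swap_mul_mem_cylinder_iff (C := {q | q ∈ K}) hc hσ, hZ]
        simp [hσK]
      simp only [mulVec_single_one, col_apply, listMatrix, of_apply, Set.indicator_of_mem hm]
      classical
      simp only [Set.indicator_apply, hz]
      rw [permResample, PMF.bind_apply, tsum_fintype, smul_eq_mul, Finset.mul_sum]
      refine Finset.sum_congr rfl fun z _ => ?_
      refine (congrArg (· * _)
        (PMF.uniformOfFinset_apply (s := Z) ⟨p.2, by simp [hZ]⟩ z)).trans ?_
      split_ifs <;> simp [*]
    · have hm : σ ∉ cylinder {q | q ∈ p :: K} := fun h =>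
        hσK fun q hq => h q (List.mem_cons_of_mem _ hq)
      have hz : ∀ z, swap p.2 z * σ ∉ cylinder {q | q ∈ K} := fun z h =>
        hσK ((swap_mul_mem_cylinder_iff hc hσ z).1 h).1
      simp only [mulVec_single_one, col_apply, listMatrix, of_apply, Set.indicator_of_notMem hm,
        Set.indicator_of_notMem (hz _)]
      simp
  · have hm : σ ∉ cylinder {q | q ∈ p :: K} := fun h => hσ (h p List.mem_cons_self)
    simp only [mulVec_single_one, col_apply, listMatrix, of_apply, Set.indicator_of_notMem hm]
    simp [hσ]

theorem listMatrix_eq_smul_prod {K : List (Fin n × Fin n)} (hK : CompatList K) :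
    ∃ c : ℝ≥0∞, listMatrix K = c • (K.map atomMatrix).prod := by
  induction K with
  | nil => exact ⟨1, by simp [listMatrix_nil]⟩
  | cons p K ih =>
    obtain ⟨c, hc⟩ := listMatrix_cons hK
    obtain ⟨d, hd⟩ := ih hK.of_cons
    exact ⟨c * d, by rw [hc, hd, List.map_cons, List.prod_cons, Matrix.mul_smul, smul_smul]⟩

theorem listMatrix_commute {K K' : List (Fin n × Fin n)} (hK : CompatList K)
    (hK' : CompatList K') (h : ∀ p ∈ K, ∀ q ∈ K', Compat p q) :
    Commute (listMatrix K) (listMatrix K') := by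
  obtain ⟨c, hc⟩ := listMatrix_eq_smul_prod hK
  obtain ⟨d, hd⟩ := listMatrix_eq_smul_prod hK'
  rw [hc, hd]
  refine Commute.smul_left (Commute.smul_right ?_ _) _
  refine Commute.list_prod_left _ _ fun A hA => Commute.list_prod_right _ _ fun B hB => ?_
  obtain ⟨p, hp, rfl⟩ := List.mem_map.1 hA
  obtain ⟨q, hq, rfl⟩ := List.mem_map.1 hB
  exact atomMatrix_commute (h p hp q hq)

theorem Consistent.reduceList {C : Set (Fin n × Fin n)} (hC : Consistent C)
    (K : List (Fin n × Fin n)) : Consistent (reduceList K C) := by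
  induction K with
  | nil => exact hC
  | cons p K ih => exact ih.reduce p

theorem listMatrix_mulVec_indicator {C : Set (Fin n × Fin n)} (hC : Consistent C)
    {K : List (Fin n × Fin n)} (hK : CompatList K) :
    ∃ c : ℝ≥0∞,
      listMatrix K *ᵥ cylinderIndicator C = c • cylinderIndicator (reduceList K C) := by
  induction K with
  | nil => exact ⟨1, by rw [listMatrix_nil, one_mulVec, one_smul]; rfl⟩
  | cons p K ih =>
    obtain ⟨c, hc⟩ := listMatrix_cons hK
    obtain ⟨d, hd⟩ := ih hK.of_cons
    obtain ⟨e, he⟩ := atomMatrix_mulVec_indicator (hC.reduceList K) p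
    refine ⟨c * (d * e), ?_⟩
    rw [hc, smul_mulVec, ← mulVec_mulVec, hd, mulVec_smul, he, smul_smul, smul_smul,
      mul_assoc]
    rfl

theorem listMatrix_mulVec_le (K : List (Fin n × Fin n)) {v : Perm (Fin n) → ℝ≥0∞}
    (hv : ∀ τ, v τ ≤ 1) (σ : Perm (Fin n)) : (listMatrix K *ᵥ v) σ ≤ 1 := by
  rw [mulVec, dotProduct]
  calc ∑ τ, listMatrix K σ τ * v τ ≤ ∑ τ, permResample K σ τ * 1 := by
        refine Finset.sum_le_sum fun τ _ => mul_le_mul' ?_ (hv τ)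
        rw [listMatrix, of_apply]
        exact Set.indicator_apply_le' (fun _ => le_rfl) fun _ => zero_le
    _ = 1 := by simp_rw [mul_one]; rw [← tsum_fintype (L := .unconditional _), PMF.tsum_coe]

/-- The third clause of `reduce` would need an earlier event that gives `p.1` another value, which
compatibility excludes. -/
theorem mem_or_mem_of_mem_reduceList {C : Set (Fin n × Fin n)} {K : List (Fin n × Fin n)}
    (hK : CompatList K) (h : ∀ p ∈ K, ∀ q ∈ C, Compat p q) :
    ∀ q ∈ reduceList K C, q ∈ C ∨ q ∈ K := by
  induction K with
  | nil => exact fun q hq => Or.inl hq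
  | cons p K ih =>
    have ih := ih hK.of_cons fun p hp => h p (List.mem_cons_of_mem _ hp)
    rintro q (rfl | ⟨hq, -⟩ | ⟨hq, -, -, hne⟩)
    · exact Or.inr List.mem_cons_self
    · exact (ih q hq).imp_right (List.mem_cons_of_mem _)
    · have hc : Compat p (p.1, q.2) := by
        rcases ih _ hq with hq | hq
        · exact h p List.mem_cons_self _ hq
        · exact hK.compat p List.mem_cons_self _ (List.mem_cons_of_mem _ hq)
      exact absurd (hc.1 rfl).symm hne

theorem subset_reduceList {C : Set (Fin n × Fin n)} {K : List (Fin n × Fin n)}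
    (hK : CompatList K) (h : ∀ p ∈ K, ∀ q ∈ C, Compat p q) : C ⊆ reduceList K C := by
  induction K with
  | nil => exact subset_rfl
  | cons p K ih =>
    have h' : ∀ p ∈ K, ∀ q ∈ C, Compat p q := fun p hp => h p (List.mem_cons_of_mem _ hp)
    refine (ih hK.of_cons h').trans (subset_reduce fun q hq => ?_)
    rcases mem_or_mem_of_mem_reduceList hK.of_cons h' q hq with hq | hq
    · exact h p List.mem_cons_self q hq
    · exact hK.compat p List.mem_cons_self q (List.mem_cons_of_mem _ hq)

theorem cylinderIndicator_le_one (C : Set (Fin n × Fin n)) (σ : Perm (Fin n)) :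
    cylinderIndicator C σ ≤ 1 :=
  Set.indicator_apply_le' (fun _ => le_rfl) fun _ => zero_le

/-- A permutation satisfying `r` given compatible atomic events is one of `(n - r)!`. -/
theorem card_cylinder_mul_descFactorial_le (s : Finset (Fin n × Fin n))
    (hs : Consistent (s : Set (Fin n × Fin n))) :
    Nat.card (cylinder (s : Set (Fin n × Fin n))) * n.descFactorial s.card ≤ n.factorial := by
  induction s using Finset.induction_on with
  | empty =>
    simp only [cylinder, Finset.coe_empty, Set.mem_empty_iff_false, false_imp_iff, implies_true,
      Finset.card_empty, Nat.descFactorial_zero, mul_one]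
    rw [Set.ofPred_true, Nat.card_univ, Nat.card_perm, Nat.card_fin]
  | insert p s hp ih =>
    have hs' : Consistent (s : Set (Fin n × Fin n)) := fun a ha b hb =>
      hs a (Finset.mem_insert_of_mem ha) b (Finset.mem_insert_of_mem hb)
    refine le_trans ?_ (ih hs')
    rw [Finset.card_insert_of_notMem hp, Nat.descFactorial_succ, ← mul_assoc]
    refine Nat.mul_le_mul_right _ ?_
    -- From a permutation satisfying `p` and `s`, swapping `p.2` with any `z` in `Z` gives a
    -- permutation satisfying `s`. Its value at `p.1` is `z`, so the pair can be recovered.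
    let Z := (s.image Prod.snd)ᶜ
    have hZ : n - s.card ≤ Nat.card Z := by
      rw [Nat.card_eq_fintype_card, Fintype.card_coe, Finset.card_compl, Fintype.card_fin]
      exact Nat.sub_le_sub_left Finset.card_image_le n
    refine (Nat.mul_le_mul_left _ hZ).trans ?_
    rw [← Nat.card_prod]
    have hc : ∀ q ∈ (s : Set (Fin n × Fin n)), Compat p q := fun q hq =>
      hs p (Finset.mem_insert_self _ _) q (Finset.mem_insert_of_mem hq)
    have hmem : ∀ σ ∈ cylinder ((insert p s : Finset _) : Set (Fin n × Fin n)),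
        σ p.1 = p.2 ∧ σ ∈ cylinder (s : Set (Fin n × Fin n)) := fun σ hσ =>
      ⟨hσ p (Finset.mem_insert_self _ _), fun q hq => hσ q (Finset.mem_insert_of_mem hq)⟩
    refine Nat.card_le_card_of_injective
      (fun x : cylinder ((insert p s : Finset _) : Set (Fin n × Fin n)) × Z =>
        (⟨swap p.2 x.2.1 * x.1.1, (swap_mul_mem_cylinder_iff hc (hmem _ x.1.2).1 _).2
          ⟨(hmem _ x.1.2).2, fun q hq => ?_⟩⟩ : cylinder (s : Set (Fin n × Fin n)))) ?_
    · have hz := x.2.2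
      simp only [Z, Finset.mem_compl, Finset.mem_image, not_exists, not_and] at hz
      refine swap_apply_of_ne_of_ne (fun h => ?_) (hz q hq)
      have h1 := (hc q hq).2 h.symm
      exact hp (by rwa [Prod.ext h1 h.symm])
    · rintro ⟨⟨σ, hσ⟩, ⟨z, hz⟩⟩ ⟨⟨τ, hτ⟩, ⟨w, hw⟩⟩ h
      have h := congrArg Subtype.val h
      simp only at h
      have hzw : z = w := by
        have := congrArg (fun π : Perm (Fin n) => π p.1) h
        simpa [(hmem σ hσ).1, (hmem τ hτ).1] using this
      subst hzw
      have := mul_left_cancel h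
      subst this
      rfl

theorem card_cylinder_le (s : Finset (Fin n × Fin n))
    (hs : Consistent (s : Set (Fin n × Fin n))) (hn : s.card ≤ n) :
    Nat.card (cylinder (s : Set (Fin n × Fin n))) ≤ (n - s.card).factorial := by
  have h := card_cylinder_mul_descFactorial_le s hs
  rw [← Nat.factorial_mul_descFactorial hn] at h
  exact Nat.le_of_mul_le_mul_right h (Nat.descFactorial_pos.2 hn)

/-! ### Assigning flaws to the atomic events that they contradict -/

section Matching

set_option linter.unusedSectionVars false

variable {ι : Type} {a : ι → List (Fin n × Fin n)}

/-- `ψ` assigns to the flaws in `T` distinct atomic events in `C` that they contradict. -/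
structure IsMatching (a : ι → List (Fin n × Fin n)) (T : Finset ι) (C : Set (Fin n × Fin n))
    (ψ : ι → Fin n × Fin n) : Prop where
  injOn : Set.InjOn ψ T
  mem : ∀ t ∈ T, ψ t ∈ C
  conflict : ∀ t ∈ T, ∃ p ∈ a t, ¬ Compat p (ψ t)

variable [DecidableEq ι] {T : Finset ι} {C : Set (Fin n × Fin n)} {ψ : ι → Fin n × Fin n}

theorem IsMatching.insert (h : IsMatching a T C ψ) {f : ι} (hf : f ∉ T) {e : Fin n × Fin n}
    (he : e ∈ C) (hfe : ∃ p ∈ a f, ¬ Compat p e) (hTe : ∀ t ∈ T, ψ t ≠ e) :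
    IsMatching a (insert f T) C (Function.update ψ f e) := by
  have hne : ∀ t ∈ T, Function.update ψ f e t = ψ t := fun t ht =>
    Function.update_of_ne (ne_of_mem_of_not_mem ht hf) _ _
  refine ⟨?_, ?_, ?_⟩
  · intro s hs t ht hst
    rw [Finset.mem_coe, Finset.mem_insert] at hs ht
    rcases hs with rfl | hs <;> rcases ht with rfl | ht
    · rfl
    · rw [hne t ht, Function.update_self] at hst
      exact absurd hst.symm (hTe t ht)
    · rw [hne s hs, Function.update_self] at hst
      exact absurd hst (hTe s hs)
    · rw [hne s hs, hne t ht] at hst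
      exact h.injOn hs ht hst
  · intro t ht
    rcases Finset.mem_insert.1 ht with rfl | ht
    · rwa [Function.update_self]
    · rw [hne t ht]
      exact h.mem t ht
  · intro t ht
    rcases Finset.mem_insert.1 ht with rfl | ht
    · rwa [Function.update_self]
    · rw [hne t ht]
      exact h.conflict t ht

theorem IsMatching.mono {D : Set (Fin n × Fin n)} {S : Finset ι} (h : IsMatching a T C ψ)
    (hS : S ⊆ T) (hCD : ∀ t ∈ S, ψ t ∈ D) : IsMatching a S D ψ :=
  ⟨h.injOn.mono (by exact_mod_cast hS), hCD, fun t ht => h.conflict t (hS ht)⟩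

/-- By consistency of `C`, at most one event of `reduce C g` comes from the third clause, namely
`(x, y)` with `(g.1, y)` and `(x, g.2)` in `C`. The flaw assigned to it contradicts one of these
two, and the other stays free. The free event, which contradicts `g`, is what a further flaw will be
assigned to. -/
theorem IsMatching.of_reduce (hC : Consistent C) {g : Fin n × Fin n}
    (h : IsMatching a T (reduce C g) ψ) (hg : ∀ t ∈ T, ∀ p ∈ a t, Compat p g) :
    ∃ ψ', IsMatching a T C ψ' ∧
      ((∃ q ∈ C, ¬ Compat g q) → ∃ e ∈ C, ¬ Compat g e ∧ ∀ t ∈ T, ψ' t ≠ e) := by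
  have hsplit : ∀ t ∈ T, (ψ t ∈ C ∧ (ψ t).1 ≠ g.1 ∧ (ψ t).2 ≠ g.2) ∨
      ((g.1, (ψ t).2) ∈ C ∧ ((ψ t).1, g.2) ∈ C ∧ (ψ t).1 ≠ g.1 ∧ (ψ t).2 ≠ g.2) := by
    intro t ht
    refine (h.mem t ht).resolve_left fun hc => ?_
    obtain ⟨p, hp, hpc⟩ := h.conflict t ht
    exact hpc (hc ▸ hg t ht p hp)
  by_cases h0 : ∃ t ∈ T, ¬ (ψ t ∈ C ∧ (ψ t).1 ≠ g.1 ∧ (ψ t).2 ≠ g.2)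
  · obtain ⟨t, ht, hn⟩ := h0
    obtain ⟨h1, h2, h3, h4⟩ := (hsplit t ht).resolve_left hn
    have hother : ∀ s ∈ T, s ≠ t → ψ s ∈ C ∧ (ψ s).1 ≠ g.1 ∧ (ψ s).2 ≠ g.2 := by
      intro s hs hst
      refine (hsplit s hs).resolve_right fun ⟨h1', h2', _, _⟩ => hst (h.injOn hs ht ?_)
      exact Prod.ext ((hC _ h2' _ h2).2 rfl) ((hC _ h1' _ h1).1 rfl)
    have key : ∀ e e', e ∈ C → e' ∈ C → (e.1 = g.1 ∨ e.2 = g.2) → (e'.1 = g.1 ∨ e'.2 = g.2) →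
        e ≠ e' → (∃ p ∈ a t, ¬ Compat p e) → ¬ Compat g e' →
        ∃ ψ', IsMatching a T C ψ' ∧
          ((∃ q ∈ C, ¬ Compat g q) → ∃ e ∈ C, ¬ Compat g e ∧ ∀ t ∈ T, ψ' t ≠ e) := by
      intro e e' he he' heg he'g hee hp hge'
      have hne : ∀ e, (e.1 = g.1 ∨ e.2 = g.2) → ∀ s ∈ T, s ≠ t → ψ s ≠ e := by
        rintro e heg s hs hst rfl
        obtain ⟨-, h5, h6⟩ := hother s hs hst
        exact heg.elim h5 h6
      have hm : IsMatching a (T.erase t) C ψ := h.mono (Finset.erase_subset _ _) fun s hs =>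
        (hother s (Finset.mem_of_mem_erase hs) (Finset.ne_of_mem_erase hs)).1
      have hm' := hm.insert (Finset.notMem_erase t T) he hp fun s hs =>
        hne e heg s (Finset.mem_of_mem_erase hs) (Finset.ne_of_mem_erase hs)
      rw [Finset.insert_erase ht] at hm'
      refine ⟨_, hm', fun _ => ⟨e', he', hge', fun s hs => ?_⟩⟩
      by_cases hst : s = t
      · rw [hst, Function.update_self]
        exact hee
      · rw [Function.update_of_ne hst]
        exact hne e' he'g s hs hst
    obtain ⟨p, hp, hpc⟩ := h.conflict t ht
    have hpg := hg t ht p hp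
    unfold Compat at hpc hpg
    -- If `p` shares its point with `ψ t`, it contradicts `((ψ t).1, g.2)`: since `p` is compatible
    -- with `g` and `p.1 ≠ g.1`, also `p.2 ≠ g.2`. Otherwise it shares its value and contradicts
    -- `(g.1, (ψ t).2)`.
    by_cases h5 : p.1 = (ψ t).1
    · refine key _ _ h2 h1 (Or.inr rfl) (Or.inl rfl) (fun hc => h3 (by simpa using congrArg Prod.fst hc))
        ⟨p, hp, ?_⟩ ?_
      · unfold Compat
        grind
      · unfold Compat
        grind
    · refine key _ _ h1 h2 (Or.inl rfl) (Or.inr rfl) (fun hc => h3 (by simpa using (congrArg Prod.fst hc).symm))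
        ⟨p, hp, ?_⟩ ?_
      · unfold Compat
        grind
      · unfold Compat
        grind
  · push Not at h0
    refine ⟨ψ, h.mono subset_rfl fun t ht => (h0 t ht).1, ?_⟩
    rintro ⟨q, hq, hgq⟩
    refine ⟨q, hq, hgq, fun t ht hc => hgq ?_⟩
    obtain ⟨-, h1, h2⟩ := h0 t ht
    rw [hc] at h1 h2
    exact iff_of_false h1.symm h2.symm

theorem IsMatching.of_reduceList (hC : Consistent C) {K : List (Fin n × Fin n)}
    (h : IsMatching a T (reduceList K C) ψ) (hK : ∀ t ∈ T, ∀ p ∈ a t, ∀ q ∈ K, Compat p q) :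
    ∃ ψ', IsMatching a T C ψ' := by
  induction K generalizing ψ with
  | nil => exact ⟨ψ, h⟩
  | cons g K ih =>
    obtain ⟨ψ', h', -⟩ := IsMatching.of_reduce (hC.reduceList K) h fun t ht p hp =>
      hK t ht p hp g List.mem_cons_self
    exact ih h' fun t ht p hp q hq => hK t ht p hp q (List.mem_cons_of_mem _ hq)

theorem IsMatching.insert_of_reduceList (hC : Consistent C) {f : ι} (hf : f ∉ T)
    (haf : CompatList (a f)) {K : List (Fin n × Fin n)} (hKf : K.Sublist (a f))
    (h : IsMatching a T (reduceList K C) ψ) (hK : ∀ t ∈ T, ∀ p ∈ a t, ∀ q ∈ K, Compat p q)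
    (hconf : ∃ p ∈ K, ∃ q ∈ C, ¬ Compat p q) :
    ∃ ψ', IsMatching a (Insert.insert f T) C ψ' := by
  induction K generalizing ψ with
  | nil => simp at hconf
  | cons g K ih =>
    have hKf' : K.Sublist (a f) := (List.sublist_cons_self g K).trans hKf
    have hK' : ∀ t ∈ T, ∀ p ∈ a t, ∀ q ∈ K, Compat p q :=
      fun t ht p hp q hq => hK t ht p hp q (List.mem_cons_of_mem _ hq)
    obtain ⟨ψ', h', hspare⟩ := IsMatching.of_reduce (hC.reduceList K) h fun t ht p hp =>
      hK t ht p hp g List.mem_cons_self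
    -- The free event for `f` is taken at the last `g` in the list that contradicts `C`. The events
    -- after `g` are compatible with `C`, so `C` survives their reduction and `g` still meets its
    -- conflict. The enlarged matching is then pulled back through them, since the events of `f` are
    -- compatible with each other.
    by_cases hcK : ∃ p ∈ K, ∃ q ∈ C, ¬ Compat p q
    · exact ih hKf' h' hK' hcK
    · have hgC : ∃ q ∈ C, ¬ Compat g q := by
        obtain ⟨p, hp, q, hq, hpq⟩ := hconf
        rcases List.mem_cons.1 hp with rfl | hp
        · exact ⟨q, hq, hpq⟩
        · exact absurd ⟨p, hp, q, hq, hpq⟩ hcK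
      push Not at hcK
      obtain ⟨q, hq, hgq⟩ := hgC
      obtain ⟨e, he, hge, hTe⟩ :=
        hspare ⟨q, subset_reduceList (haf.sublist hKf') hcK hq, hgq⟩
      refine (h'.insert hf he ⟨g, hKf.subset List.mem_cons_self, hge⟩ hTe).of_reduceList hC ?_
      intro t ht p hp q hq
      rcases Finset.mem_insert.1 ht with rfl | ht
      · exact haf.compat p hp q (hKf'.subset hq)
      · exact hK' t ht p hp q hq

end Matching

end PermFlaws

/-! ### Products of transition matrices along a layering -/

section LayersMatrix

set_option linter.unusedSectionVars false

open Matrix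

variable {Ω ι : Type} [Fintype Ω] [DecidableEq Ω]

def layerMatrix (A : ι → Matrix Ω Ω ℝ≥0∞) (I : Finset ι) : Matrix Ω Ω ℝ≥0∞ :=
  (I.toList.map A).prod

/-- The product of the layers, the first one on the right. -/
def layersMatrix (A : ι → Matrix Ω Ω ℝ≥0∞) : List (Finset ι) → Matrix Ω Ω ℝ≥0∞
  | [] => 1
  | J :: L => layersMatrix A L * layerMatrix A J

variable {A : ι → Matrix Ω Ω ℝ≥0∞} {dep : ι → ι → Prop}

theorem layerMatrix_empty : layerMatrix A ∅ = 1 := by simp [layerMatrix]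

theorem commute_layerMatrix (hA : ∀ f g, ¬ dep f g → Commute (A f) (A g)) {f : ι}
    {I : Finset ι} (h : ¬ Touches dep f I) : Commute (A f) (layerMatrix A I) := by
  refine Commute.list_prod_right _ _ fun B hB => ?_
  obtain ⟨g, hg, rfl⟩ := List.mem_map.1 hB
  exact hA f g fun hd => h ⟨g, Finset.mem_toList.1 hg, hd⟩

theorem commute_layersMatrix (hA : ∀ f g, ¬ dep f g → Commute (A f) (A g)) {f : ι}
    {L : List (Finset ι)} (h : ¬ ∃ K ∈ L, Touches dep f K) :
    Commute (A f) (layersMatrix A L) := by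
  induction L with
  | nil => exact Commute.one_right _
  | cons J L ih =>
    exact (ih fun ⟨K, hK, ht⟩ => h ⟨K, List.mem_cons_of_mem _ hK, ht⟩).mul_right
      (commute_layerMatrix hA fun ht => h ⟨J, List.mem_cons_self, ht⟩)

variable [DecidableEq ι]

theorem layerMatrix_insert (hr : ∀ f, dep f f) (hs : ∀ f g, dep f g → dep g f)
    (hA : ∀ f g, ¬ dep f g → Commute (A f) (A g)) {f : ι} {I : Finset ι} (hI : Indep dep I)
    (hf : ¬ Touches dep f I) : layerMatrix A (insert f I) = A f * layerMatrix A I := by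
  have hfI : f ∉ I := fun h => hf ⟨f, h, hr f⟩
  rw [layerMatrix, layerMatrix, ← List.prod_cons, ← List.map_cons]
  refine ((Finset.toList_insert hfI).map A).prod_eq' ?_
  rw [List.pairwise_map]
  refine (Finset.nodup_toList _).imp_of_mem fun {a b} ha hb hab => hA a b ?_
  exact hI.insert hs hf a (Finset.mem_toList.1 ha) b (Finset.mem_toList.1 hb) hab

/-- Later layers stand to the left, and `f` commutes with all those that it passes on its way to its
own layer. -/
theorem layersMatrix_insertLayer (hr : ∀ f, dep f f) (hs : ∀ f g, dep f g → dep g f)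
    (hA : ∀ f g, ¬ dep f g → Commute (A f) (A g)) (f : ι) {I : Finset ι}
    {L : List (Finset ι)} (h : IsLayering dep I L) :
    layersMatrix A (insertLayer dep f L) = A f * layersMatrix A L := by
  induction L generalizing I with
  | nil => simp [insertLayer, layersMatrix, layerMatrix]
  | cons J L ih =>
    rw [insertLayer]
    split_ifs with ht
    · rw [layersMatrix, layersMatrix, ih h.2.2.2, mul_assoc]
    · have hJ : ¬ Touches dep f J := fun hJ => ht ⟨J, List.mem_cons_self, hJ⟩
      have hL : ¬ ∃ K ∈ L, Touches dep f K :=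
        fun ⟨K, hK, h⟩ => ht ⟨K, List.mem_cons_of_mem _ hK, h⟩
      rw [layersMatrix, layersMatrix, layerMatrix_insert hr hs hA h.2.1 hJ, ← mul_assoc,
        ← (commute_layersMatrix hA hL).eq, mul_assoc]

variable {γ : ι → ℝ≥0∞} {w : Ω → ℝ≥0∞}

theorem dotProduct_layerMatrix_mulVec_le (hw : ∀ f v, w ⬝ᵥ (A f *ᵥ v) ≤ γ f * (w ⬝ᵥ v))
    (I : Finset ι) (v : Ω → ℝ≥0∞) :
    w ⬝ᵥ (layerMatrix A I *ᵥ v) ≤ (∏ f ∈ I, γ f) * (w ⬝ᵥ v) := by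
  rw [layerMatrix, ← Finset.prod_map_toList]
  induction I.toList with
  | nil => simp
  | cons f l ih =>
    rw [List.map_cons, List.prod_cons, List.map_cons, List.prod_cons, ← mulVec_mulVec, mul_assoc]
    exact (hw f _).trans (by gcongr)

theorem dotProduct_layersMatrix_mulVec_le (hw : ∀ f v, w ⬝ᵥ (A f *ᵥ v) ≤ γ f * (w ⬝ᵥ v))
    (L : List (Finset ι)) (v : Ω → ℝ≥0∞) :
    w ⬝ᵥ (layersMatrix A L *ᵥ v) ≤ layersWeight γ L * (w ⬝ᵥ v) := by
  induction L generalizing v with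
  | nil => simp [layersMatrix, layersWeight]
  | cons J L ih =>
    rw [layersMatrix, ← mulVec_mulVec, layersWeight_cons, mul_comm (∏ f ∈ J, γ f), mul_assoc]
    exact (ih _).trans (by gcongr; exact dotProduct_layerMatrix_mulVec_le hw J v)

theorem mulVec_mono (M : Matrix Ω Ω ℝ≥0∞) {v v' : Ω → ℝ≥0∞} (h : v ≤ v') :
    M *ᵥ v ≤ M *ᵥ v' := fun _ =>
  Finset.sum_le_sum fun τ _ => mul_le_mul_right (h τ) _

theorem mulVec_tsum {α : Type} (M : Matrix Ω Ω ℝ≥0∞) (u : α → Ω → ℝ≥0∞) (σ : Ω) :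
    (M *ᵥ fun τ => ∑' x, u x τ) σ = ∑' x, (M *ᵥ u x) σ := by
  simp only [mulVec, dotProduct, ← ENNReal.tsum_mul_left]
  exact (Summable.tsum_finsetSum fun _ _ => ENNReal.summable).symm

end LayersMatrix

/-! ### The flaws that a witness DAG of a set of atomic events may end with -/

section Orderable

set_option linter.unusedSectionVars false

open Matrix Equiv

variable {n : ℕ} {ι : Type} [DecidableEq ι]

/-- The set `I` can be ordered such that each of its flaws contradicts what remains of `E` after
reduction by the preceding flaws; `C` is what remains in the end. -/
inductive Orderable (dep : ι → ι → Prop) (a : ι → List (Fin n × Fin n))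
    (E : Set (Fin n × Fin n)) : Finset ι → Set (Fin n × Fin n) → Prop
  | empty : Orderable dep a E ∅ E
  | insert {f : ι} {I : Finset ι} {C : Set (Fin n × Fin n)} (h : Orderable dep a E I C)
    (hf : ¬ Touches dep f I) (hconf : ∃ p ∈ a f, ∃ q ∈ C, ¬ Compat p q) :
    Orderable dep a E (insert f I) (reduceList (a f) C)

/-- A commuting family of flaws with their lists of atomic events. -/
structure CompatFamily (dep : ι → ι → Prop) (a : ι → List (Fin n × Fin n)) : Prop where
  refl : ∀ f, dep f f
  symm : ∀ f g, dep f g → dep g f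
  compatList : ∀ f, CompatList (a f)
  compat : ∀ f g, ¬ dep f g → ∀ p ∈ a f, ∀ q ∈ a g, Compat p q

variable {dep : ι → ι → Prop} {a : ι → List (Fin n × Fin n)} {E C : Set (Fin n × Fin n)}
  {I : Finset ι}

theorem CompatFamily.commute (ha : CompatFamily dep a) (f g : ι) (h : ¬ dep f g) :
    Commute (listMatrix (a f)) (listMatrix (a g)) :=
  listMatrix_commute (ha.compatList f) (ha.compatList g) (ha.compat f g h)

theorem Orderable.indep (ha : CompatFamily dep a) (h : Orderable dep a E I C) :
    Indep dep I := by
  induction h with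
  | empty => intro f hf; simp at hf
  | insert _ hf _ ih => exact ih.insert ha.symm hf

theorem Orderable.consistent (hE : Consistent E) (h : Orderable dep a E I C) :
    Consistent C := by
  induction h with
  | empty => exact hE
  | insert _ _ _ ih => exact ih.reduceList _

theorem Orderable.isMatching_union (ha : CompatFamily dep a) (hE : Consistent E)
    (h : Orderable dep a E I C) {T : Finset ι} (hT : Disjoint T I) (hTI : Indep dep (T ∪ I))
    {ψ : ι → Fin n × Fin n} (hψ : IsMatching a T C ψ) : ∃ ψ', IsMatching a (T ∪ I) E ψ' := by
  -- The flaw `f` added last is moved from `I` to `T`: undoing its reduction keeps the assignment of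
  -- `T` and frees an event for `f`.
  induction h generalizing T ψ with
  | empty => exact ⟨ψ, by rwa [Finset.union_empty]⟩
  | @insert f I C h hf hconf ih =>
    rw [Finset.disjoint_insert_right] at hT
    have hfI : f ∉ I := fun hm => hf ⟨f, hm, ha.refl f⟩
    have hu : T ∪ Insert.insert f I = Insert.insert f T ∪ I := by
      rw [Finset.union_insert, Finset.insert_union]
    have hK : ∀ t ∈ T, ∀ p ∈ a t, ∀ q ∈ a f, Compat p q := by
      intro t ht
      refine ha.compat t f (hTI t (Finset.mem_union_left _ ht) f
        (Finset.mem_union_right _ (Finset.mem_insert_self _ _)) ?_)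
      exact ne_of_mem_of_not_mem ht hT.1
    obtain ⟨ψ', h'⟩ := hψ.insert_of_reduceList (h.consistent hE) hT.1 (ha.compatList f)
      (List.Sublist.refl _) hK hconf
    rw [hu] at hTI ⊢
    exact ih (Finset.disjoint_insert_left.2 ⟨hfI, hT.2⟩) hTI h'

theorem Orderable.exists_isMatching [Nonempty (Fin n × Fin n)] (ha : CompatFamily dep a)
    (hE : Consistent E) (h : Orderable dep a E I C) : ∃ ψ, IsMatching a I E ψ := by
  have hψ : IsMatching a ∅ C fun _ => Classical.arbitrary _ := ⟨by simp, by simp, by simp⟩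
  simpa using h.isMatching_union ha hE (Finset.disjoint_empty_left I)
    (by simpa using h.indep ha) hψ

theorem Orderable.layerMatrix_mulVec (ha : CompatFamily dep a) (hE : Consistent E)
    (h : Orderable dep a E I C) :
    ∃ c : ℝ≥0∞, layerMatrix (fun f => listMatrix (a f)) I *ᵥ cylinderIndicator E =
      c • cylinderIndicator C := by
  induction h with
  | empty => exact ⟨1, by rw [layerMatrix_empty, one_mulVec, one_smul]⟩
  | @insert f I C h hf hconf ih =>
    obtain ⟨c, hc⟩ := ih
    obtain ⟨d, hd⟩ := listMatrix_mulVec_indicator (h.consistent hE) (ha.compatList f)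
    refine ⟨c * d, ?_⟩
    rw [layerMatrix_insert ha.refl ha.symm ha.commute (h.indep ha) hf, ← mulVec_mulVec, hc,
      mulVec_smul, hd, smul_smul]

/-- The left side is at most `1`, the matrix being substochastic, and is supported on the reduced
cylinder, which lies in that of `C`. -/
theorem listMatrix_mulVec_indicator_le (hC : Consistent C) {K : List (Fin n × Fin n)}
    (hK : CompatList K) (h : ∀ p ∈ K, ∀ q ∈ C, Compat p q) :
    listMatrix K *ᵥ cylinderIndicator C ≤ cylinderIndicator C := by
  intro σ
  by_cases hσ : σ ∈ cylinder C
  · have : cylinderIndicator C σ = 1 := by simp [cylinderIndicator, hσ]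
    rw [this]
    exact listMatrix_mulVec_le K (cylinderIndicator_le_one C) σ
  · have hσ' : σ ∉ cylinder (reduceList K C) :=
      fun hm => hσ fun p hp => hm p (subset_reduceList hK h hp)
    obtain ⟨c, hc⟩ := listMatrix_mulVec_indicator hC hK
    rw [hc]
    simp [cylinderIndicator, hσ']

/-! ### The potential -/

/-- The layerings whose first layer is orderable. -/
abbrev OrderableLayering (dep : ι → ι → Prop) (a : ι → List (Fin n × Fin n))
    (E : Set (Fin n × Fin n)) : Type :=
  Σ I : {I : Finset ι // ∃ C, Orderable dep a E I C}, {L // IsLayering dep I.1 L}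

theorem OrderableLayering.ext {x y : OrderableLayering dep a E} (h1 : x.1.1 = y.1.1)
    (h2 : x.2.1 = y.2.1) : x = y := by
  obtain ⟨⟨I, hI⟩, ⟨L, hL⟩⟩ := x
  obtain ⟨⟨J, hJ⟩, ⟨M, hM⟩⟩ := y
  dsimp only at h1 h2
  subst h1 h2
  rfl

def OrderableLayering.vec (x : OrderableLayering dep a E) : Perm (Fin n) → ℝ≥0∞ :=
  layersMatrix (fun f => listMatrix (a f)) x.2.1 *ᵥ
    (layerMatrix (fun f => listMatrix (a f)) x.1.1 *ᵥ cylinderIndicator E)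

variable (dep a E) in
def orderablePotential (σ : Perm (Fin n)) : ℝ≥0∞ :=
  ∑' x : OrderableLayering dep a E, x.vec σ

-- Left multiplication by the matrix of `f`, seen on layerings. If `f` touches nothing, it becomes a
-- new sink when the enlarged set is orderable; otherwise it is absorbed.
open Classical in
def OrderableLayering.prepend (ha : CompatFamily dep a) (f : ι)
    (x : OrderableLayering dep a E) : OrderableLayering dep a E :=
  if ht : Touches dep f x.1.1 ∨ ∃ K ∈ x.2.1, Touches dep f K then
    ⟨x.1, ⟨insertLayer dep f x.2.1, x.2.2.insertLayer ha.symm ht⟩⟩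
  else if ho : ∃ C, Orderable dep a E (insert f x.1.1) C then
    ⟨⟨insert f x.1.1, ho⟩, ⟨x.2.1, x.2.2.mono (Finset.subset_insert _ _)⟩⟩
  else x

/-- The three cases have disjoint images: in the result `f` touches a later layer, or only the
sinks, or nothing at all. -/
theorem OrderableLayering.prepend_injective (ha : CompatFamily dep a) (f : ι) :
    Function.Injective (prepend ha f : OrderableLayering dep a E → _) := by
  have h12 : ∀ x y : OrderableLayering dep a E, ¬ (∃ K ∈ y.2.1, Touches dep f K) →
      insertLayer dep f x.2.1 ≠ y.2.1 := by
    intro x y hy hxy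
    exact hy (hxy ▸ touches_insertLayer ha.refl f x.2.1)
  have h23 : ∀ I J : Finset ι, ¬ Touches dep f J → insert f I ≠ J := by
    intro I J hJ hIJ
    exact hJ ⟨f, hIJ ▸ Finset.mem_insert_self _ _, ha.refl f⟩
  intro x y hxy
  unfold prepend at hxy
  split_ifs at hxy with hx hy hoy hox hy hoy hy hoy
  all_goals
    have h1 := congrArg (fun z : OrderableLayering dep a E => z.1.1) hxy
    have h2 := congrArg (fun z : OrderableLayering dep a E => z.2.1) hxy
  · exact OrderableLayering.ext h1 (insertLayer_injective ha.refl x.2.2 y.2.2 h2)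
  · exact absurd h2 (h12 x y fun h => hy (Or.inr h))
  · exact absurd h2 (h12 x y fun h => hy (Or.inr h))
  · exact absurd h2.symm (h12 y x fun h => hx (Or.inr h))
  · have hfx : f ∉ x.1.1 := fun h => hx (Or.inl ⟨f, h, ha.refl f⟩)
    have hfy : f ∉ y.1.1 := fun h => hy (Or.inl ⟨f, h, ha.refl f⟩)
    refine OrderableLayering.ext ?_ h2
    rw [← Finset.erase_insert hfx, ← Finset.erase_insert hfy]
    exact congrArg (Finset.erase · f) h1
  · exact absurd h1 (h23 _ _ fun h => hy (Or.inl h))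
  · exact absurd h2.symm (h12 y x fun h => hx (Or.inr h))
  · exact absurd h1.symm (h23 _ _ fun h => hx (Or.inl h))
  · exact OrderableLayering.ext h1 h2

theorem OrderableLayering.mulVec_vec_le (ha : CompatFamily dep a) (hE : Consistent E) (f : ι)
    (x : OrderableLayering dep a E) :
    listMatrix (a f) *ᵥ x.vec ≤ (x.prepend ha f).vec := by
  unfold prepend
  split_ifs with ht ho
  · simp only [vec]
    rw [layersMatrix_insertLayer ha.refl ha.symm ha.commute f x.2.2, mulVec_mulVec]
  all_goals
    have hI : ¬ Touches dep f x.1.1 := fun h => ht (Or.inl h)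
    have hL : ¬ ∃ K ∈ x.2.1, Touches dep f K := fun h => ht (Or.inr h)
    have hcomm := (commute_layersMatrix (A := fun f => listMatrix (a f)) ha.commute hL).eq
    obtain ⟨C, hC⟩ := x.1.2
    simp only [vec]
    rw [mulVec_mulVec, hcomm, ← mulVec_mulVec]
  · rw [layerMatrix_insert ha.refl ha.symm ha.commute (hC.indep ha) hI, ← mulVec_mulVec]
  · refine mulVec_mono _ ?_
    obtain ⟨c, hc⟩ := hC.layerMatrix_mulVec ha hE
    rw [hc, mulVec_smul]
    intro σ
    refine mul_le_mul_right (listMatrix_mulVec_indicator_le (hC.consistent hE)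
      (ha.compatList f) ?_ σ) _
    by_contra hconf
    push Not at hconf
    -- A conflict of `f` with the remaining `C` would make the enlarged set of sinks orderable,
    -- against `ho`.
    exact ho ⟨_, hC.insert hI hconf⟩

theorem mulVec_orderablePotential_le (ha : CompatFamily dep a) (hE : Consistent E) (f : ι)
    (σ : Perm (Fin n)) :
    (listMatrix (a f) *ᵥ orderablePotential dep a E) σ ≤ orderablePotential dep a E σ := by
  unfold orderablePotential
  rw [mulVec_tsum]
  calc ∑' x : OrderableLayering dep a E, (listMatrix (a f) *ᵥ x.vec) σ
      ≤ ∑' x : OrderableLayering dep a E, (x.prepend ha f).vec σ :=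
        ENNReal.tsum_le_tsum fun x => x.mulVec_vec_le ha hE f σ
    _ ≤ _ := ENNReal.tsum_comp_le_tsum_of_injective
        (OrderableLayering.prepend_injective ha f) fun x => x.vec σ

theorem one_le_orderablePotential {σ : Perm (Fin n)} (hσ : σ ∈ cylinder E) :
    1 ≤ orderablePotential dep a E σ := by
  refine le_trans ?_ (ENNReal.le_tsum
    (⟨⟨∅, E, Orderable.empty⟩, ⟨[], trivial⟩⟩ : OrderableLayering dep a E))
  simp [OrderableLayering.vec, layersMatrix, layerMatrix_empty, cylinderIndicator, hσ]

theorem dotProduct_orderablePotential_le {γ : ι → ℝ≥0∞} {w : Perm (Fin n) → ℝ≥0∞}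
    (hw : ∀ f v, w ⬝ᵥ (listMatrix (a f) *ᵥ v) ≤ γ f * (w ⬝ᵥ v)) :
    w ⬝ᵥ orderablePotential dep a E ≤ (w ⬝ᵥ cylinderIndicator E) *
      ∑' I : {I : Finset ι // ∃ C, Orderable dep a E I C}, layerSum dep γ I.1 := by
  have h1 : w ⬝ᵥ orderablePotential dep a E =
      ∑' x : OrderableLayering dep a E, w ⬝ᵥ x.vec := by
    simp only [dotProduct, orderablePotential, ← ENNReal.tsum_mul_left]
    exact (Summable.tsum_finsetSum fun _ _ => ENNReal.summable).symm
  rw [h1, ENNReal.tsum_sigma', ← ENNReal.tsum_mul_left]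
  refine ENNReal.tsum_le_tsum fun I => ?_
  rw [layerSum, ← ENNReal.tsum_mul_left, ← ENNReal.tsum_mul_left]
  refine ENNReal.tsum_le_tsum fun L => ?_
  rw [OrderableLayering.vec]
  refine (dotProduct_layersMatrix_mulVec_le hw _ _).trans ?_
  calc layersWeight γ L.1 * (w ⬝ᵥ (layerMatrix _ I.1 *ᵥ cylinderIndicator E))
      ≤ layersWeight γ L.1 * ((∏ f ∈ I.1, γ f) * (w ⬝ᵥ cylinderIndicator E)) := by
        gcongr
        exact dotProduct_layerMatrix_mulVec_le hw _ _
    _ = _ := by ring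

end Orderable

/-! ### Summing over the orderable sets of sinks -/

section Bound

open Matrix Equiv

variable {n : ℕ} {ι : Type} [DecidableEq ι] {dep : ι → ι → Prop}
  {a : ι → List (Fin n × Fin n)}

open Classical in
theorem tsum_orderable_layerSum_le [Fintype ι] [Nonempty (Fin n × Fin n)]
    (ha : CompatFamily dep a) (γ : ι → ℝ≥0∞) {r : ℕ} {g : Fin r → Fin n × Fin n}
    (hE : Consistent (Set.range g)) :
    ∑' I : {I : Finset ι // ∃ C, Orderable dep a (Set.range g) I C}, layerSum dep γ I.1 ≤
      ∏ i, (1 + ∑ f, if ∃ p ∈ a f, ¬ Compat p (g i) then layerSum dep γ {f} else 0) := by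
  let W : Fin r → Option ι → ℝ≥0∞ := fun i o =>
    o.elim 1 fun f => if ∃ p ∈ a f, ¬ Compat p (g i) then layerSum dep γ {f} else 0
  have hW : ∀ i, 1 + ∑ f, (if ∃ p ∈ a f, ¬ Compat p (g i) then layerSum dep γ {f} else 0) =
      ∑ o, W i o := fun i => by rw [Fintype.sum_option]; rfl
  have hφ : ∀ I : {I : Finset ι // ∃ C, Orderable dep a (Set.range g) I C},
      ∃ φ : ι → Option (Fin r), Set.InjOn φ I.1 ∧
        ∀ f ∈ I.1, ∃ i, φ f = some i ∧ ∃ p ∈ a f, ¬ Compat p (g i) := by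
    rintro ⟨I, C, hC⟩
    obtain ⟨ψ, hψ⟩ := hC.exists_isMatching ha hE
    let φ : ι → Option (Fin r) := fun f => if h : ∃ i, g i = ψ f then some h.choose else none
    have hφ : ∀ f ∈ I, ∃ i, φ f = some i ∧ g i = ψ f := by
      intro f hf
      have h : ∃ i, g i = ψ f := hψ.mem f hf
      exact ⟨h.choose, dif_pos h, h.choose_spec⟩
    refine ⟨φ, fun f hf f' hf' hff => ?_, fun f hf => ?_⟩
    · obtain ⟨i, hi, hgi⟩ := hφ f hf
      obtain ⟨i', hi', hgi'⟩ := hφ f' hf'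
      rw [hi, hi', Option.some_inj] at hff
      subst hff
      exact hψ.injOn hf hf' (hgi.symm.trans hgi')
    · obtain ⟨i, hi, hgi⟩ := hφ f hf
      refine ⟨i, hi, ?_⟩
      rw [hgi]
      exact hψ.conflict f hf
  choose φ hinj hconf using hφ
  -- Each `I` selects one term in the expansion of the product: for every `i` the flaw assigned to
  -- `g i`, or `none`, which stands for the summand `1`. The flaws selected recover `I`.
  let e : {I : Finset ι // ∃ C, Orderable dep a (Set.range g) I C} → Fin r → Option ι :=
    fun I i => if h : ∃ f ∈ I.1, φ I f = some i then some h.choose else none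
  have he : ∀ I i f, e I i = some f ↔ f ∈ I.1 ∧ φ I f = some i := by
    intro I i f
    simp only [e]
    split_ifs with h
    · obtain ⟨h1, h2⟩ := h.choose_spec
      rw [Option.some_inj]
      constructor
      · rintro rfl
        exact ⟨h1, h2⟩
      · rintro ⟨h3, h4⟩
        exact hinj I h1 h3 (h2.trans h4.symm)
    · simp only [false_iff]
      exact fun hf => h ⟨f, hf⟩
  have hmem : ∀ I f, f ∈ I.1 ↔ ∃ i, e I i = some f := by
    intro I f
    constructor
    · intro hf
      obtain ⟨i, hi, -⟩ := hconf I f hf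
      exact ⟨i, (he I i f).2 ⟨hf, hi⟩⟩
    · rintro ⟨i, hi⟩
      exact ((he I i f).1 hi).1
  have hei : Function.Injective e := by
    intro I J hIJ
    refine Subtype.ext (Finset.ext fun f => ?_)
    rw [hmem, hmem, hIJ]
  have hprod : ∀ I, ∏ f ∈ I.1, layerSum dep γ {f} = ∏ i, W i (e I i) := by
    intro I
    have hW1 : ∀ i, W i (e I i) = (e I i).elim 1 fun f => layerSum dep γ {f} := by
      intro i
      cases h : e I i with
      | none => rfl
      | some f =>
        obtain ⟨hf, hfi⟩ := (he I i f).1 h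
        obtain ⟨j, hj, hp⟩ := hconf I f hf
        rw [hj, Option.some_inj] at hfi
        subst hfi
        exact if_pos hp
    simp_rw [hW1]
    symm
    rw [← Finset.prod_filter_of_ne (p := fun i => (e I i).isSome)]
    · refine Finset.prod_bij (fun i hi => (e I i).get (Finset.mem_filter.1 hi).2) ?_ ?_ ?_ ?_
      · intro i hi
        exact ((he I i _).1 (Option.some_get _).symm).1
      · intro i hi j hj hij
        have h1 := ((he I i _).1 (Option.some_get (Finset.mem_filter.1 hi).2).symm).2
        have h2 := ((he I j _).1 (Option.some_get (Finset.mem_filter.1 hj).2).symm).2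
        rw [hij, h2, Option.some_inj] at h1
        exact h1.symm
      · intro f hf
        obtain ⟨i, hi⟩ := (hmem I f).1 hf
        exact ⟨i, by simp [hi], by simp [hi]⟩
      · intro i hi
        obtain ⟨f, hf⟩ := Option.isSome_iff_exists.1 (Finset.mem_filter.1 hi).2
        simp [hf]
    · intro i _ hi
      cases h : e I i with
      | none => rw [h] at hi; exact absurd rfl hi
      | some f => rfl
  calc _ ≤ ∑' I : {I : Finset ι // ∃ C, Orderable dep a (Set.range g) I C},
        ∏ i, W i (e I i) :=
        ENNReal.tsum_le_tsum fun I => (layerSum_le_prod γ I.1).trans (hprod I).le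
    _ ≤ ∑' x : Fin r → Option ι, ∏ i, W i (x i) :=
        ENNReal.tsum_comp_le_tsum_of_injective hei fun x => ∏ i, W i (x i)
    _ = _ := by
        rw [tsum_fintype]
        simp_rw [hW]
        rw [Finset.prod_univ_sum, Fintype.piFinset_univ]

end Bound

/-! ### The permutation setting as an instance -/

section PermSetting

open Matrix Equiv

variable {n : ℕ} (F : PermSetting n)

theorem PermSetting.coe_eq_cylinder (f : F.oracle.flaws) :
    (f : Set (Perm (Fin n))) = cylinder {p | p ∈ F.atoms f} := by
  have h : (f : Set (Perm (Fin n))) = ⋂ p ∈ F.atoms f, atom p := F.eq_inter f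
  rw [h]
  ext σ
  simp [cylinder, atom]

theorem PermSetting.transition_eq (f : F.oracle.flaws) (σ τ : Perm (Fin n)) :
    F.oracle.transition f σ τ = listMatrix (F.atoms f) σ τ := by
  rw [ResamplingOracle.transition, F.coe_eq_cylinder f]
  rfl

theorem PermSetting.compatFamily :
    CompatFamily F.dep (fun f : F.oracle.flaws => F.atoms f) where
  refl f := Or.inl rfl
  symm f g h := h.imp Eq.symm fun h => by rwa [Set.inter_comm]
  compatList f := F.atoms_compatible f
  compat f g h p hp q hq := by
    unfold PermSetting.dep at h
    push Not at h
    obtain ⟨σ, hf, hg⟩ := h.2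
    rw [F.coe_eq_cylinder] at hf hg
    have hC : σ ∈ cylinder ({p | p ∈ F.atoms f} ∪ {p | p ∈ F.atoms g}) := by
      rintro p (hp | hp)
      · exact hf p hp
      · exact hg p hp
    exact compat_of_mem_cylinder hC (Or.inl hp) (Or.inr hq)

theorem permUniform_apply (σ : Perm (Fin n)) :
    permUniform n σ = (n.factorial : ℝ≥0∞)⁻¹ := by
  rw [permUniform, PMF.uniformOfFintype_apply, Fintype.card_perm, Fintype.card_fin]

/-- The definition of the charge with its denominator cleared, that is, $\mu A_f\le\gamma_f\mu$;
this is legitimate as `permUniform n τ` is neither `0` nor infinite. -/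
theorem PermSetting.sum_mul_listMatrix_le (f : F.oracle.flaws) (τ : Perm (Fin n)) :
    ∑ σ, permUniform n σ * listMatrix (F.atoms f) σ τ ≤
      F.oracle.charge (permUniform n) f * permUniform n τ := by
  have h0 : permUniform n τ ≠ 0 := by
    rw [permUniform_apply]
    exact ENNReal.inv_ne_zero.2 (ENNReal.natCast_ne_top _)
  have hle : ∑' σ : (f : Set (Perm (Fin n))),
      permUniform n σ / permUniform n τ * F.oracle.transition f σ τ ≤
      F.oracle.charge (permUniform n) f :=
    le_iSup (fun τ : Perm (Fin n) => ∑' σ : (f : Set (Perm (Fin n))),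
      permUniform n σ / permUniform n τ * F.oracle.transition f σ τ) τ
  refine le_trans (le_of_eq ?_) (mul_le_mul_left hle _)
  rw [← ENNReal.tsum_mul_right, tsum_subtype (f : Set (Perm (Fin n))) fun σ =>
    permUniform n σ / permUniform n τ * F.oracle.transition f σ τ * permUniform n τ,
    tsum_fintype]
  refine Finset.sum_congr rfl fun σ _ => ?_
  by_cases hσ : σ ∈ (f : Set (Perm (Fin n)))
  · rw [Set.indicator_of_mem hσ, F.transition_eq, mul_right_comm,
      ENNReal.div_mul_cancel h0 (PMF.apply_ne_top _ _)]
  · rw [Set.indicator_of_notMem hσ, ← F.transition_eq, ResamplingOracle.transition,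
      Set.indicator_of_notMem hσ, mul_zero]

theorem PermSetting.dotProduct_listMatrix_mulVec_le (f : F.oracle.flaws)
    (v : Perm (Fin n) → ℝ≥0∞) :
    (permUniform n : Perm (Fin n) → ℝ≥0∞) ⬝ᵥ (listMatrix (F.atoms f) *ᵥ v) ≤
      F.oracle.charge (permUniform n) f *
        ((permUniform n : Perm (Fin n) → ℝ≥0∞) ⬝ᵥ v) := by
  rw [dotProduct_mulVec, dotProduct, dotProduct, Finset.mul_sum]
  refine Finset.sum_le_sum fun τ _ => ?_
  rw [← mul_assoc]
  exact mul_le_mul_left (F.sum_mul_listMatrix_le f τ) _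

theorem dotProduct_cylinderIndicator_le {r : ℕ} (hr : r ≤ n) {g : Fin r → Fin n × Fin n}
    (hg : Function.Injective g) (hE : Consistent (Set.range g)) :
    (permUniform n : Perm (Fin n) → ℝ≥0∞) ⬝ᵥ cylinderIndicator (Set.range g) ≤
      ((n - r).factorial : ℝ≥0∞) / (n.factorial : ℝ≥0∞) := by
  classical
  have hs : ((Finset.univ.map ⟨g, hg⟩ : Finset _) : Set (Fin n × Fin n)) = Set.range g := by
    simp
  have hcard := card_cylinder_le (Finset.univ.map ⟨g, hg⟩) (by rwa [hs]) (by simpa using hr)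
  rw [hs, Finset.card_map, Finset.card_univ, Fintype.card_fin] at hcard
  have : (permUniform n : Perm (Fin n) → ℝ≥0∞) ⬝ᵥ cylinderIndicator (Set.range g) =
      (n.factorial : ℝ≥0∞)⁻¹ * (Nat.card (cylinder (Set.range g)) : ℝ≥0∞) := by
    simp only [dotProduct, permUniform_apply, cylinderIndicator]
    rw [← Finset.mul_sum, Nat.card_eq_fintype_card, Fintype.card_subtype]
    simp [Set.indicator_apply]
  rw [this, mul_comm, div_eq_mul_inv]
  gcongr

theorem PermSetting.sum_layerSum_le (p : Fin n × Fin n) [Fintype F.oracle.flaws]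
    [DecidableEq F.oracle.flaws]
    [DecidablePred fun f : F.oracle.flaws => ∃ q ∈ F.atoms f, ¬ Compat q p] :
    ∑ f : F.oracle.flaws, (if ∃ q ∈ F.atoms f, ¬ Compat q p then
        layerSum F.dep (F.oracle.charge (permUniform n)) {f} else 0) ≤
      ∑' f : {f : F.oracle.flaws // (f : Set (Perm (Fin n))) ∩ atom p = ∅}, F.psi f.1 := by
  refine le_of_le_of_eq ?_
    (tsum_subtype {f : F.oracle.flaws | (f : Set (Perm (Fin n))) ∩ atom p = ∅} F.psi).symm
  rw [tsum_fintype]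
  refine Finset.sum_le_sum fun f _ => ?_
  split_ifs with h
  · rw [Set.indicator_of_mem]
    · exact layerSum_singleton_le_Psi F.compatFamily.symm _ f
    · obtain ⟨q, hq, hc⟩ := h
      refine Set.eq_empty_of_forall_notMem fun σ ⟨hf, hσ⟩ => hc ?_
      rw [F.coe_eq_cylinder] at hf
      have hC : σ ∈ cylinder (insert p {q | q ∈ F.atoms f}) := by
        rintro q (rfl | hq)
        · exact hσ
        · exact hf q hq
      exact compat_of_mem_cylinder hC (Or.inr hq) (Or.inl rfl)
  · exact zero_le

end PermSetting

end

end LLL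

theorem theorem5p5 (n : ℕ) (F : LLL.PermSetting n) (S : LLL.SelectionRule F.oracle)
    (r : ℕ) (hr : r ≤ n) (g : Fin r → Fin n × Fin n) (hg : Function.Injective g) :
    S.hitProb (LLL.permUniform n) (⋂ i, LLL.atom (g i)) ≤
      ((n - r).factorial : ENNReal) / (n.factorial : ENNReal) *
        ∏ i : Fin r, (1 + ∑' f : {f : F.oracle.flaws //
          (f : Set (Equiv.Perm (Fin n))) ∩ LLL.atom (g i) = ∅}, F.psi f.1) := by
  classical
  have hcyl : (⋂ i, LLL.atom (g i)) = LLL.cylinder (Set.range g) := by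
    ext σ
    simp [LLL.cylinder, LLL.atom]
  rw [hcyl]
  -- For `n = 0` there is no atomic event to serve as a default value of an assignment; the constant
  -- potential `1` suffices.
  rcases Nat.eq_zero_or_pos n with rfl | hn
  · obtain rfl : r = 0 := Nat.le_zero.1 hr
    refine (LLL.hitProb_le_of_potential (U := fun _ => 1) (fun _ _ => le_rfl)
      (fun f σ _ => ?_) S _).trans ?_
    · simpa using PMF.coe_le_one _ _
    · simpa using PMF.coe_le_one _ _
  by_cases hE : LLL.Consistent (Set.range g)
  · have : Nonempty (Fin n × Fin n) := ⟨(⟨0, hn⟩, ⟨0, hn⟩)⟩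
    have : Fintype F.oracle.flaws := Fintype.ofFinite _
    have ha := F.compatFamily
    refine (LLL.hitProb_le_of_potential
      (U := LLL.orderablePotential F.dep (fun f => F.atoms f) (Set.range g))
      (fun σ hσ => LLL.one_le_orderablePotential hσ) (fun f σ hσ => ?_) S _).trans ?_
    · refine le_trans (le_of_eq ?_) (LLL.mulVec_orderablePotential_le ha hE f σ)
      rw [tsum_fintype]
      refine Finset.sum_congr rfl fun τ _ => ?_
      refine congrArg (· * _) ((F.transition_eq f σ τ).symm.trans ?_).symm
      rw [LLL.ResamplingOracle.transition, Set.indicator_of_mem hσ]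
    · rw [tsum_fintype]
      refine (LLL.dotProduct_orderablePotential_le F.dotProduct_listMatrix_mulVec_le).trans ?_
      refine mul_le_mul' (LLL.dotProduct_cylinderIndicator_le hr hg hE) ?_
      refine (LLL.tsum_orderable_layerSum_le ha _ hE).trans ?_
      refine Finset.prod_le_prod' fun i _ => add_le_add le_rfl ?_
      refine le_trans (le_of_eq ?_) (F.sum_layerSum_le (g i))
      congr!
  -- Contradictory events `g i` make $E$ empty, so the zero potential works.
  · have hempty : ∀ σ, σ ∉ LLL.cylinder (Set.range g) := fun σ hσ =>
      hE fun p hp q hq => LLL.compat_of_mem_cylinder hσ hp hq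
    refine (LLL.hitProb_le_of_potential (U := fun _ => 0) (fun σ hσ => absurd hσ (hempty σ))
      (fun f σ _ => ?_) S _).trans ?_
    · simp
    · simp
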